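/- Let $\mathbb F_q$ be a finite field, $d$ a nonnegative integer, and for $k=1,2,3$ let $\mathbf V_k\in\mathbb F_q^{d\times m_k}$ and $\mathbf V_k'\in\mathbb F_q^{d\times m_k'}$ be arbitrary matrices. Consider the 3-user linear computation broadcast problem (LCBC) in which, for every data vector $\mathbf x\in\mathbb F_q^{d}$, user $k$ knows $\mathbf x^T\mathbf V_k'$ and wants $\mathbf x^T\mathbf V_k$. A coding scheme consists of a batch size $L\ge 1$, a finite alphabet $\mathcal S$, an encoder $\Phi:\mathbb F_q^{d\times L}\to\mathcal S$ and decoders $\Psi_k:\mathcal S\times\mathbb F_q^{L\times m_k'}\to\mathbb F_q^{L\times m_k}$ (none of them necessarily linear) such that $\Psi_k(\Phi(\mathbf X),\mathbf X^T\mathbf V_k')=\mathbf X^T\mathbf V_k$ for all $\mathbf X\in\mathbb F_q^{d\times L}$ and $k=1,2,3$. The optimal broadcast cost is $\Delta^*=\inf \frac{\log_q|\mathcal S|}{L}$, the infimum being over all coding schemes. For subspaces $A,B$ of $\mathbb F_q^d$ put $\mathrm{rk}(A\mid B)=\dim(A+B)-\dim B$, with a matrix standing for its column span. Let $\mathbf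 U_k$ be the column span of $[\mathbf V_k',\mathbf V_k]$, and put $\mathbf U_{ij}=\mathbf U_i\cap\mathbf U_j$, $\mathbf U_{123}=\mathbf U_1\cap\mathbf U_2\cap\mathbf U_3$, $\mathbf U_{i(j,k)}=\mathbf U_i\cap(\mathbf U_j+\mathbf U_k)$. Then the linear program $$F^*=\min\ \mathrm{rk}(\mathbf V_1|\mathbf V_1')+\mathrm{rk}(\mathbf V_2|\mathbf V_2')+\mathrm{rk}(\mathbf V_3|\mathbf V_3')-2\lambda_{123}-\lambda_{12}-\lambda_{13}-\lambda_{23}-\lambda$$ over real numbers $\lambda_{123},\lambda_{12},\lambda_{13},\lambda_{23},\lambda\ge 0$ subject to $$\lambda_{123}\le \mathrm{rk}(\mathbf U_{123}|\mathbf V_k'),\quad k=1,2,3,$$ $$\lambda_{ij}+\lambda_{123}\le \mathrm{rk}(\mathbf U_{ij}|\mathbf V_k'),\quad (i,j)\in\{(1,2),(1,3),(2,3)\},\ k\in\{i,j\},$$ $$\lambda_{12}+\lambda_{13}+\lambda_{123}\le \mathrm{rk}(\mathbf U_{12}+\mathbf U_{13}|\mathbf V_1'),$$ $$\lambda_{12}+\lambda_{23}+\lambda_{123}\le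 \mathrm{rk}(\mathbf U_{12}+\mathbf U_{23}|\mathbf V_2'),$$ $$\lambda_{13}+\lambda_{23}+\lambda_{123}\le \mathrm{rk}(\mathbf U_{13}+\mathbf U_{23}|\mathbf V_3'),$$ $$\lambda+\lambda_{12}+\lambda_{13}+\lambda_{123}\le \mathrm{rk}(\mathbf U_{1(2,3)}|\mathbf V_1'),$$ $$\lambda+\lambda_{12}+\lambda_{23}+\lambda_{123}\le \mathrm{rk}(\mathbf U_{2(1,3)}|\mathbf V_2'),$$ $$\lambda+\lambda_{13}+\lambda_{23}+\lambda_{123}\le \mathrm{rk}(\mathbf U_{3(1,2)}|\mathbf V_3')$$ attains its minimum, and $\Delta^*=F^*$. -/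

import Mathlib

universe u

noncomputable section

/-- The column span `⟨M⟩` of a matrix. -/
def colSpan {F : Type u} [Field F] {d : ℕ} {n : Type*} (M : Matrix (Fin d) n F) :
    Submodule F (Fin d → F) :=
  Submodule.span F (Set.range M.col)

/-- Concatenating matrices column-wise corresponds to the sum of the column spans. -/
theorem colSpan_fromCols {F : Type u} [Field F] {d : ℕ} {n₁ n₂ : Type*}
    (A : Matrix (Fin d) n₁ F) (B : Matrix (Fin d) n₂ F) :
    colSpan (Matrix.fromCols A B) = colSpan A ⊔ colSpan B := by
  have h : Set.range (Matrix.fromCols A B).col = Set.range A.col ∪ Set.range B.col := by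
    ext v
    constructor
    · rintro ⟨j | j, rfl⟩
      · exact Or.inl ⟨j, rfl⟩
      · exact Or.inr ⟨j, rfl⟩
    · rintro (⟨j, rfl⟩ | ⟨j, rfl⟩)
      · exact ⟨Sum.inl j, rfl⟩
      · exact ⟨Sum.inr j, rfl⟩
  rw [colSpan, h, Submodule.span_union]; rfl

/-- The conditional rank `rk(M₁ | M₂) = rk([M₁, M₂]) - rk(M₂)`. It depends only on the column
spans `A = ⟨M₁⟩` and `B = ⟨M₂⟩`, and `⟨[M₁, M₂]⟩ = A ⊔ B`. -/
def condRank {F : Type u} [Field F] {d : ℕ} (A B : Submodule F (Fin d → F)) : ℝ :=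
  (Module.finrank F ↥(A ⊔ B) : ℝ) - (Module.finrank F ↥B : ℝ)

/-- An instance of the `K`-user linear computation broadcast problem with data dimension `d`:
user `k` has side information `xᵀ V' k` and wants `xᵀ V k`. -/
structure LCBC (F : Type u) (K d : ℕ) where
  /-- The number of demanded projections of each user. -/
  m : Fin K → ℕ
  /-- The number of side-information projections of each user. -/
  m' : Fin K → ℕ
  /-- The demand matrices. -/
  V : (k : Fin K) → Matrix (Fin d) (Fin (m k)) F
  /-- The side-information matrices. -/
  V' : (k : Fin K) → Matrix (Fin d) (Fin (m' k)) F

namespace LCBC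

/-- A coding scheme with batch size `L` and broadcast alphabet `S`: an arbitrary (not necessarily
linear) encoder and decoders such that every user recovers its demand for every realization of
the data. -/
structure Scheme {F : Type u} [Field F] {K d : ℕ} (P : LCBC F K d) (L : ℕ) (S : Type u) where
  /-- The encoder. -/
  enc : Matrix (Fin d) (Fin L) F → S
  /-- The decoders. -/
  dec : (k : Fin K) → S → Matrix (Fin L) (Fin (P.m' k)) F → Matrix (Fin L) (Fin (P.m k)) F
  /-- Zero-error decodability. -/
  decodes : ∀ (k : Fin K) (X : Matrix (Fin d) (Fin L) F),
    dec k (enc X) (X.transpose * P.V' k) = X.transpose * P.V k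

/-- The set of all normalized costs `log_q |S| / L` of coding schemes, over all batch sizes
`L ≥ 1` and all finite alphabets `S`. -/
def achievableCosts {F : Type u} [Field F] [Fintype F] {K d : ℕ} (P : LCBC F K d) : Set ℝ :=
  {c | ∃ (L : ℕ) (S : Type u) (_ : Fintype S), 0 < L ∧ Nonempty (P.Scheme L S) ∧
    c = Real.logb (Fintype.card F) (Fintype.card S) / L}

/-- The optimal broadcast cost per computation `Δ*`, in `q`-ary units. -/
def optimalBroadcastCost {F : Type u} [Field F] [Fintype F] {K d : ℕ} (P : LCBC F K d) : ℝ :=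
  sInf P.achievableCosts

/-- `⟨V'ₖ⟩`. -/
def sideSpace {F : Type u} [Field F] {K d : ℕ} (P : LCBC F K d) (k : Fin K) :
    Submodule F (Fin d → F) :=
  colSpan (P.V' k)

/-- `⟨Uₖ⟩` with `Uₖ = [V'ₖ, Vₖ]`. -/
def U {F : Type u} [Field F] {K d : ℕ} (P : LCBC F K d) (k : Fin K) :
    Submodule F (Fin d → F) :=
  colSpan (Matrix.fromCols (P.V' k) (P.V k))

/-- `⟨Uᵢⱼ⟩ = ⟨Uᵢ⟩ ∩ ⟨Uⱼ⟩`. -/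
def U₂ {F : Type u} [Field F] {K d : ℕ} (P : LCBC F K d) (i j : Fin K) :
    Submodule F (Fin d → F) :=
  P.U i ⊓ P.U j

/-- The triple intersection of `⟨Uᵢ⟩`, `⟨Uⱼ⟩` and `⟨Uₖ⟩`. -/
def U₃ {F : Type u} [Field F] {K d : ℕ} (P : LCBC F K d) (i j k : Fin K) :
    Submodule F (Fin d → F) :=
  P.U i ⊓ P.U j ⊓ P.U k

/-- `⟨U_{i(j,k)}⟩ = ⟨Uᵢ⟩ ∩ ⟨[Uⱼ, Uₖ]⟩`. -/
def UParen {F : Type u} [Field F] {K d : ℕ} (P : LCBC F K d) (i j k : Fin K) :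
    Submodule F (Fin d → F) :=
  P.U i ⊓ (P.U j ⊔ P.U k)

/-- The five real variables of the linear program. -/
structure LPVars where
  l123 : ℝ
  l12 : ℝ
  l13 : ℝ
  l23 : ℝ
  l : ℝ

/-- Feasibility in the linear program: nonnegativity and the fifteen rank constraints.
Users 1, 2, 3 are the indices `0, 1, 2 : Fin 3`. -/
structure LPFeasible {F : Type u} [Field F] {d : ℕ} (P : LCBC F 3 d) (x : LPVars) : Prop where
  nonneg_l123 : 0 ≤ x.l123
  nonneg_l12 : 0 ≤ x.l12
  nonneg_l13 : 0 ≤ x.l13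
  nonneg_l23 : 0 ≤ x.l23
  nonneg_l : 0 ≤ x.l
  c123_1 : x.l123 ≤ condRank (P.U₃ 0 1 2) (P.sideSpace 0)
  c123_2 : x.l123 ≤ condRank (P.U₃ 0 1 2) (P.sideSpace 1)
  c123_3 : x.l123 ≤ condRank (P.U₃ 0 1 2) (P.sideSpace 2)
  c12_1 : x.l12 + x.l123 ≤ condRank (P.U₂ 0 1) (P.sideSpace 0)
  c12_2 : x.l12 + x.l123 ≤ condRank (P.U₂ 0 1) (P.sideSpace 1)
  c13_1 : x.l13 + x.l123 ≤ condRank (P.U₂ 0 2) (P.sideSpace 0)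
  c13_3 : x.l13 + x.l123 ≤ condRank (P.U₂ 0 2) (P.sideSpace 2)
  c23_2 : x.l23 + x.l123 ≤ condRank (P.U₂ 1 2) (P.sideSpace 1)
  c23_3 : x.l23 + x.l123 ≤ condRank (P.U₂ 1 2) (P.sideSpace 2)
  c12_13 : x.l12 + x.l13 + x.l123 ≤ condRank (P.U₂ 0 1 ⊔ P.U₂ 0 2) (P.sideSpace 0)
  c12_23 : x.l12 + x.l23 + x.l123 ≤ condRank (P.U₂ 0 1 ⊔ P.U₂ 1 2) (P.sideSpace 1)
  c13_23 : x.l13 + x.l23 + x.l123 ≤ condRank (P.U₂ 0 2 ⊔ P.U₂ 1 2) (P.sideSpace 2)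
  c1 : x.l + x.l12 + x.l13 + x.l123 ≤ condRank (P.UParen 0 1 2) (P.sideSpace 0)
  c2 : x.l + x.l12 + x.l23 + x.l123 ≤ condRank (P.UParen 1 0 2) (P.sideSpace 1)
  c3 : x.l + x.l13 + x.l23 + x.l123 ≤ condRank (P.UParen 2 0 1) (P.sideSpace 2)

/-- The objective of the linear program. -/
def lpObjective {F : Type u} [Field F] {d : ℕ} (P : LCBC F 3 d) (x : LPVars) : ℝ :=
  condRank (colSpan (P.V 0)) (P.sideSpace 0) + condRank (colSpan (P.V 1)) (P.sideSpace 1)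
    + condRank (colSpan (P.V 2)) (P.sideSpace 2)
    - 2 * x.l123 - x.l12 - x.l13 - x.l23 - x.l

/-- The objective values of the feasible points of the linear program. -/
def lpValues {F : Type u} [Field F] {d : ℕ} (P : LCBC F 3 d) : Set ℝ :=
  {v | ∃ x : LPVars, P.LPFeasible x ∧ v = P.lpObjective x}

/-- The optimal value `F*` of the linear program. -/
def lpOptimum {F : Type u} [Field F] {d : ℕ} (P : LCBC F 3 d) : ℝ :=
  sInf P.lpValues

end LCBC

end

/-! The linear program is both a lower bound, through entropy inequalities, and an upper bound,
through random-like linear coding.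

Converse. For uniform data and any encoder, let `h C` be the conditional entropy of the broadcast
given the data evaluated on a subspace `C`, normalized by the batch size in `q`-ary units. It is
nonnegative and submodular in `C`. Decodability says that adjoining `U k` costs at least the rank of
`U k` over the side information in the presence of `C`. Serving the users in sequence, or along two
chains glued by submodularity, gives the inequalities `GainBounds` for the saving, that is, the sum
of the demand ranks minus `h ⊥`. These bounds are sums of linear program constraints, halved where a
constraint is needed twice. An explicit feasible point meets the smallest of them
(`exists_optimal_waterfilling`), so it is optimal for the program and no code can beat it.

Achievability. There are five message types: one vector useful to all three users, one useful to a
given pair, and a triple of vectors with zero sum, one for each user, which costs only two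
transmissions. A message saves the number of its recipients minus its cost, which gives the weights
2, 1, 1, 1, 1 of the objective. A user profits fully when its received vectors are independent
modulo its side information. The constraints of the program imply Rado's rank condition for this
independence, and `RadoCondition.exists_step` picks messages greedily over the given field. A small
field causes only a constant loss: passing to `z`-fold powers makes the multiplicities `z * λ`
large, and the loss divided by `z` tends to zero. No field extension is needed. -/

open Module

/-! ### Avoiding subspaces over a finite field, and dimension counts -/

/-- Counting: each subspace contains at most a fraction `q ^ (-c)` of `E`, and fewer than `2 ^ c ≤ q
^ c` of them cannot cover it. Requiring codimension `c` instead of 1 is what makes this work for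
every `q`. -/
theorem exists_notMem_of_finrank_add_le {F E ι : Type*} [Field F] [Finite F] [AddCommGroup E]
    [Module F E] [FiniteDimensional F E] (s : Finset ι) (N : ι → Submodule F E) (c : ℕ)
    (hc : s.card < 2 ^ c) (hN : ∀ i ∈ s, finrank F (N i) + c ≤ finrank F E) :
    ∃ e : E, ∀ i ∈ s, e ∉ N i := by
  classical
  by_contra! hcon
  have := Fintype.ofFinite F
  have : Finite E := Module.finite_of_finite F
  have := Fintype.ofFinite E
  have hq : 2 ≤ Fintype.card F := Fintype.one_lt_card
  have hcover : (Finset.univ : Finset E) ⊆ s.biUnion fun i => Finset.univ.filter (· ∈ N i) := by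
    intro e _
    obtain ⟨i, hi, he⟩ := hcon e
    simp only [Finset.mem_biUnion, Finset.mem_filter, Finset.mem_univ, true_and]
    exact ⟨i, hi, he⟩
  have hcard : ∀ i ∈ s, (Finset.univ.filter (· ∈ N i)).card * Fintype.card F ^ c
      ≤ Fintype.card F ^ finrank F E := by
    intro i hi
    have h1 : (Finset.univ.filter (· ∈ N i)).card = Fintype.card F ^ finrank F (N i) := by
      rw [← Module.card_eq_pow_finrank (K := F) (V := N i), Fintype.card_subtype]
    rw [h1, ← pow_add]
    exact Nat.pow_le_pow_right (by omega) (hN i hi)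
  have h2 : Fintype.card F ^ finrank F E
      ≤ ∑ i ∈ s, (Finset.univ.filter (· ∈ N i)).card := by
    rw [← Module.card_eq_pow_finrank (K := F) (V := E), ← Finset.card_univ]
    exact (Finset.card_le_card hcover).trans Finset.card_biUnion_le
  have h3 : Fintype.card F ^ finrank F E * Fintype.card F ^ c
      ≤ s.card * Fintype.card F ^ finrank F E := by
    calc _ ≤ (∑ i ∈ s, (Finset.univ.filter (· ∈ N i)).card) * Fintype.card F ^ c :=
          Nat.mul_le_mul_right _ h2
      _ = ∑ i ∈ s, (Finset.univ.filter (· ∈ N i)).card * Fintype.card F ^ c := Finset.sum_mul ..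
      _ ≤ ∑ i ∈ s, Fintype.card F ^ finrank F E := Finset.sum_le_sum hcard
      _ = _ := by simp
  have h4 : 2 ^ c ≤ Fintype.card F ^ c := Nat.pow_le_pow_left hq c
  have h5 : 0 < Fintype.card F ^ finrank F E := by positivity
  nlinarith

/-- Rank-nullity modulo `D`: the codimension of the preimage of `D` is the rank that `f` adds to
`D`. -/
theorem finrank_sup_range_add_finrank_comap {F E W : Type*} [Field F] [AddCommGroup E]
    [Module F E] [FiniteDimensional F E] [AddCommGroup W] [Module F W] [FiniteDimensional F W]
    (f : E →ₗ[F] W) (D : Submodule F W) :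
    finrank F ↥(D ⊔ LinearMap.range f) + finrank F ↥(D.comap f) = finrank F D + finrank F E := by
  have h1 := Submodule.finrank_sup_add_finrank_inf_eq D (LinearMap.range f)
  have h2 := LinearMap.finrank_range_add_finrank_ker f
  have h3 := LinearMap.finrank_range_add_finrank_ker (f.domRestrict (D.comap f))
  have h4 : LinearMap.range (f.domRestrict (D.comap f)) = D ⊓ LinearMap.range f := by
    rw [LinearMap.range_domRestrict, Submodule.map_comap_eq, inf_comm]
  have h5 : finrank F (LinearMap.ker (f.domRestrict (D.comap f)))
      = finrank F (LinearMap.ker f) := by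
    have hle : LinearMap.ker f ≤ D.comap f := fun x hx => by
      simp [LinearMap.mem_ker.1 hx]
    rw [LinearMap.ker_domRestrict]
    exact (Submodule.submoduleOfEquivOfLe hle).finrank_eq
  rw [h4, h5] at h3
  omega

theorem finrank_sup_span_singleton_le {F W : Type*} [Field F] [AddCommGroup W] [Module F W]
    [FiniteDimensional F W] (A : Submodule F W) (v : W) :
    finrank F ↥(A ⊔ Submodule.span F {v}) ≤ finrank F A + 1 :=
  (Submodule.finrank_add_le_finrank_add_finrank _ _).trans
    (Nat.add_le_add_left ((finrank_span_le_card _).trans (by simp)) _)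

/-! ### Greedy choice of messages under the rank condition -/

section Greedy

variable {F W κ τ : Type*} {E : τ → Type*} [Field F] [AddCommGroup W] [Module F W]
  [FiniteDimensional F W] [∀ t, AddCommGroup (E t)] [∀ t, Module F (E t)]
  [∀ t, FiniteDimensional F (E t)] [Fintype κ] [Fintype τ] [DecidableEq τ]

/-- The rank condition for choosing `n t` vectors in each `E t` so that, for every user `k`,
their images under the `π k t` with `t ∈ s k` are independent modulo `A k`. -/
def RadoCondition (s : κ → Finset τ) (π : κ → (t : τ) → E t →ₗ[F] W) (n : τ → ℕ)
    (A : κ → Submodule F W) : Prop :=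
  ∀ k, ∀ J ⊆ s k, ∑ t ∈ J, n t + finrank F (A k)
    ≤ finrank F ↥(A k ⊔ J.sup fun t => LinearMap.range (π k t))

/-- The condition for `(k, J)` with `t ∉ J` can break only if the image of `e` falls into `A k` plus
the images of the types in `J`. If the preimage of that space has codimension at least `c`, then `e`
can avoid it, there being fewer than `2 ^ c` pairs. If the codimension is smaller, the condition for
`insert t J` together with `c ≤ n t` leaves a slack of one for `J`, so falling in does no harm. -/
theorem RadoCondition.exists_step [Finite F] {s : κ → Finset τ} {π : κ → (t : τ) → E t →ₗ[F] W}
    {n : τ → ℕ} {A : κ → Submodule F W} (h : RadoCondition s π n A) {c : ℕ}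
    (hc : Fintype.card κ * 2 ^ Fintype.card τ < 2 ^ c) (t : τ) (ht : c ≤ n t) :
    ∃ (e : E t) (A' : κ → Submodule F W),
      RadoCondition s π (Function.update n t (n t - 1)) A' ∧
      (∀ k, t ∈ s k → A' k = A k ⊔ Submodule.span F {π k t e}) ∧
      (∀ k, t ∉ s k → A' k = A k) ∧
      ∀ k, t ∈ s k → finrank F (A' k) = finrank F (A k) + 1 := by
  classical
  let D : κ × Finset τ → Submodule F W := fun p =>
    A p.1 ⊔ p.2.sup fun t' => LinearMap.range (π p.1 t')
  let N : κ × Finset τ → Submodule F (E t) := fun p => (D p).comap (π p.1 t)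
  let I : Finset (κ × Finset τ) := Finset.univ.filter fun p => finrank F (N p) + c ≤ finrank F (E t)
  have hI : I.card < 2 ^ c := by
    refine lt_of_le_of_lt (Finset.card_le_univ _) ?_
    simpa [Fintype.card_prod, Fintype.card_finset] using hc
  obtain ⟨e, he⟩ := exists_notMem_of_finrank_add_le I N c hI
    (fun p hp => (Finset.mem_filter.1 hp).2)
  have key : ∀ k, t ∈ s k → ∀ J ⊆ s k, t ∉ J →
      π k t e ∉ D (k, J) ∨ ∑ t ∈ J, n t + finrank F (A k) + 1 ≤ finrank F (D (k, J)) := by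
    intro k hk J hJ htJ
    by_cases hp : (k, J) ∈ I
    · exact Or.inl fun hmem => he _ hp hmem
    · right
      have hp' : finrank F (E t) < finrank F (N (k, J)) + c := by
        simpa [I] using hp
      have h1 := finrank_sup_range_add_finrank_comap (π k t) (D (k, J))
      have h2 := h k (insert t J) (Finset.insert_subset hk hJ)
      rw [Finset.sum_insert htJ, Finset.sup_insert] at h2
      have h3 : A k ⊔ (LinearMap.range (π k t) ⊔ J.sup fun t => LinearMap.range (π k t))
          = D (k, J) ⊔ LinearMap.range (π k t) := by
        simp only [D]; rw [sup_comm (LinearMap.range (π k t)), sup_assoc]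
      rw [h3] at h2
      change finrank F ↥(D (k, J) ⊔ _) + finrank F ↥(N (k, J)) = _ at h1
      omega
  have hA'1 : ∀ k, t ∈ s k → (fun k => if t ∈ s k then A k ⊔ Submodule.span F {π k t e} else A k) k
      = A k ⊔ Submodule.span F {π k t e} := fun k hk => if_pos hk
  have hA'2 : ∀ k, t ∉ s k → (fun k => if t ∈ s k then A k ⊔ Submodule.span F {π k t e} else A k) k
      = A k := fun k hk => if_neg hk
  refine ⟨e, fun k => if t ∈ s k then A k ⊔ Submodule.span F {π k t e} else A k, ?_, hA'1, hA'2, ?_⟩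
  · intro k J hJ
    by_cases hk : t ∈ s k
    · rw [hA'1 k hk]
      have h0 := finrank_sup_span_singleton_le (A k) (π k t e)
      have hD : A k ⊔ Submodule.span F {π k t e} ⊔ (J.sup fun t => LinearMap.range (π k t))
          = D (k, J) ⊔ Submodule.span F {π k t e} := by
        simp only [D]; rw [sup_right_comm]
      rw [hD]
      have hmono : finrank F (D (k, J)) ≤ finrank F ↥(D (k, J) ⊔ Submodule.span F {π k t e}) :=
        Submodule.finrank_mono le_sup_left
      by_cases htJ : t ∈ J
      · have h1 := h k J hJ
        rw [← Finset.add_sum_erase _ _ htJ] at h1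
        rw [← Finset.add_sum_erase _ _ htJ, Function.update_self]
        have h2 : ∑ x ∈ J.erase t, Function.update n t (n t - 1) x = ∑ x ∈ J.erase t, n x :=
          Finset.sum_congr rfl fun x hx => Function.update_of_ne (Finset.ne_of_mem_erase hx) _ _
        rw [h2]
        have hn : 1 ≤ n t := by
          rcases Nat.eq_zero_or_pos c with rfl | hc0
          · have : 0 < Fintype.card κ := Fintype.card_pos_iff.2 ⟨k⟩
            have : 0 < Fintype.card κ * 2 ^ Fintype.card τ := by positivity
            simp at hc; omega
          · omega
        change _ ≤ finrank F ↥(D (k, J)) at h1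
        omega
      · have h2 : ∑ x ∈ J, Function.update n t (n t - 1) x = ∑ x ∈ J, n x :=
          Finset.sum_congr rfl fun x hx =>
            Function.update_of_ne (fun hxt : x = t => htJ (hxt ▸ hx)) _ _
        rw [h2]
        rcases key k hk J hJ htJ with hn | hn
        · rw [Submodule.finrank_sup_span_singleton hn]
          have h1 := h k J hJ
          change _ ≤ finrank F ↥(D (k, J)) at h1
          omega
        · omega
    · rw [hA'2 k hk]
      have h2 : ∑ x ∈ J, Function.update n t (n t - 1) x = ∑ x ∈ J, n x :=
        Finset.sum_congr rfl fun x hx =>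
          Function.update_of_ne (fun hxt : x = t => hk (hJ (hxt ▸ hx))) _ _
      rw [h2]
      exact h k J hJ
  · intro k hk
    rw [hA'1 k hk]
    have hD : D (k, ∅) = A k := by simp [D]
    rcases key k hk ∅ (Finset.empty_subset _) (Finset.notMem_empty _) with hn | hn
    · rw [hD] at hn
      exact Submodule.finrank_sup_span_singleton hn
    · rw [hD] at hn
      simp at hn

/-- Serving every user separately, by a complement of `A k` in `U k`, with no saving. This ends the
greedy construction. -/
theorem exists_broadcast_of_le (A U : κ → Submodule F W) (hAU : ∀ k, A k ≤ U k) :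
    ∃ B : Submodule F W, (∀ k, U k ≤ A k ⊔ B) ∧
      finrank F B + ∑ k, finrank F (A k) ≤ ∑ k, finrank F (U k) := by
  have h : ∀ k, ∃ C : Submodule F W, A k ⊔ C = U k ∧
      finrank F C + finrank F (A k) = finrank F (U k) := by
    intro k
    obtain ⟨C, hC1, hC2⟩ := IsModularLattice.exists_disjoint_and_sup_eq (hAU k)
    refine ⟨C, hC2, ?_⟩
    have := Submodule.finrank_sup_add_finrank_inf_eq (A k) C
    rw [hC2, hC1.eq_bot, finrank_bot] at this
    omega
  choose C hC1 hC2 using h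
  refine ⟨Finset.univ.sup C, fun k => ?_, ?_⟩
  · rw [← hC1 k]
    exact sup_le_sup_left (Finset.le_sup (Finset.mem_univ k)) _
  · have h1 : ∀ s : Finset κ, finrank F ↥(s.sup C) ≤ ∑ k ∈ s, finrank F (C k) := by
      classical
      intro s
      induction s using Finset.induction_on with
      | empty => simp
      | insert a s ha ih =>
        rw [Finset.sup_insert, Finset.sum_insert ha]
        exact (Submodule.finrank_add_le_finrank_add_finrank _ _).trans
          (Nat.add_le_add_left ih _)
    calc _ ≤ ∑ k, finrank F (C k) + ∑ k, finrank F (A k) := Nat.add_le_add_right (h1 _) _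
      _ = _ := by rw [← Finset.sum_add_distrib]; exact Finset.sum_congr rfl fun k _ => hC2 k

/-- Under the rank condition there is a broadcast space `B` serving all users that saves, up to
a constant, `γ t` dimensions for each of the `n t` vectors of type `t`. -/
theorem RadoCondition.exists_broadcast [Finite F] {s : κ → Finset τ} {π : κ → (t : τ) → E t →ₗ[F] W}
    {c : ℕ} (hc : Fintype.card κ * 2 ^ Fintype.card τ < 2 ^ c) (U : κ → Submodule F W)
    (hπU : ∀ k, ∀ t ∈ s k, LinearMap.range (π k t) ≤ U k) (β γ : τ → ℕ)
    (hβγ : ∀ t, β t + γ t ≤ (Finset.univ.filter fun k => t ∈ s k).card)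
    (hβ : ∀ t (e : E t), ∃ b : Submodule F W, finrank F b ≤ β t ∧ ∀ k, t ∈ s k → π k t e ∈ b)
    (n : τ → ℕ) (A : κ → Submodule F W) (hAU : ∀ k, A k ≤ U k) (h : RadoCondition s π n A) :
    ∃ B : Submodule F W, (∀ k, U k ≤ A k ⊔ B) ∧
      finrank F B + ∑ k, finrank F (A k) + ∑ t, γ t * n t
        ≤ ∑ k, finrank F (U k) + ∑ t, γ t * c := by
  classical
  induction hm : ∑ t, n t generalizing n A with
  | zero =>
    obtain ⟨B, hB1, hB2⟩ := exists_broadcast_of_le A U hAU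
    refine ⟨B, hB1, ?_⟩
    have : ∀ t, n t = 0 := by simpa using hm
    simp only [this, mul_zero, Finset.sum_const_zero]
    omega
  | succ m ih =>
    -- Once no multiplicity exceeds `c`, the remaining messages are given up. The saving forgone is
    -- at most `∑ t, γ t * c`, whatever the initial `n`.
    by_cases hall : ∀ t, n t ≤ c
    · obtain ⟨B, hB1, hB2⟩ := exists_broadcast_of_le A U hAU
      refine ⟨B, hB1, ?_⟩
      have : ∑ t, γ t * n t ≤ ∑ t, γ t * c :=
        Finset.sum_le_sum fun t _ => Nat.mul_le_mul_left _ (hall t)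
      omega
    · push Not at hall
      obtain ⟨t, ht⟩ := hall
      obtain ⟨e, A', he1, hA1, hA2, he2⟩ := h.exists_step hc t ht.le
      obtain ⟨b, hb1, hb2⟩ := hβ t e
      have hsum : ∀ f : ℕ → τ → ℕ, ∑ x, f (n x) x
          = f (n t) t + ∑ x ∈ Finset.univ.erase t, f (n x) x := fun f =>
        (Finset.add_sum_erase _ (fun x => f (n x) x) (Finset.mem_univ t)).symm
      have hsum' : ∀ f : ℕ → τ → ℕ, ∑ x, f (Function.update n t (n t - 1) x) x
          = f (n t - 1) t + ∑ x ∈ Finset.univ.erase t, f (n x) x := by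
        intro f
        rw [← Finset.add_sum_erase _ _ (Finset.mem_univ t), Function.update_self]
        congr 1
        exact Finset.sum_congr rfl fun x hx => by
          rw [Function.update_of_ne (Finset.ne_of_mem_erase hx)]
      obtain ⟨B, hB1, hB2⟩ := ih (Function.update n t (n t - 1)) A' (by
        intro k
        by_cases hk : t ∈ s k
        · rw [hA1 k hk]
          refine sup_le (hAU k) ?_
          rw [Submodule.span_singleton_le_iff_mem]
          exact hπU k t hk ⟨e, rfl⟩
        · rw [hA2 k hk]; exact hAU k) he1 (by
        have h1 := hsum fun a _ => a
        have h2 := hsum' fun a _ => a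
        omega)
      refine ⟨B ⊔ b, fun k => ?_, ?_⟩
      · refine (hB1 k).trans ?_
        by_cases hk : t ∈ s k
        · rw [hA1 k hk]
          refine sup_le (sup_le le_sup_left ?_) (le_sup_left.trans le_sup_right)
          rw [Submodule.span_singleton_le_iff_mem]
          exact (le_sup_right.trans le_sup_right : b ≤ A k ⊔ (B ⊔ b)) (hb2 k hk)
        · rw [hA2 k hk]
          exact sup_le_sup_left le_sup_left _
      -- Accounting for one message: it enlarges the known space of each recipient by one dimension
      -- and `B` by at most `β t`, so it saves at least `γ t`.
      · have h1 : ∑ k, finrank F (A' k)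
            = ∑ k, finrank F (A k) + (Finset.univ.filter fun k => t ∈ s k).card := by
          rw [Finset.card_filter, ← Finset.sum_add_distrib]
          refine Finset.sum_congr rfl fun k _ => ?_
          by_cases hk : t ∈ s k
          · rw [if_pos hk, he2 k hk]
          · rw [if_neg hk, hA2 k hk, add_zero]
        rw [h1] at hB2
        have h2 := hsum fun a t => γ t * a
        have h3 := hsum' fun a t => γ t * a
        rw [h3] at hB2
        rw [h2]
        have h4 : γ t * n t = γ t * (n t - 1) + γ t := by
          obtain ⟨m, hm⟩ : ∃ m, n t = m + 1 := ⟨n t - 1, by omega⟩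
          rw [hm]; simp; ring
        have h5 := hβγ t
        have h6 := Submodule.finrank_add_le_finrank_add_finrank B b
        omega

end Greedy

/-! ### Explicit optimum of the linear program -/

/-- Here `p` is the value of `λ₁₂₃` and `a, b, c` stand for `λ₁₂, λ₁₃, λ₂₃`. Take `G` to be the
least of the six bounds. If the total gain is `G`, the constraint `l + b + c + p ≤ t3` reads `a ≥ G
- p - t3`, and similarly for `b` and `c`. So each of these takes the smallest nonnegative value
allowed, and `l` supplies whatever is missing from `G`. Each of the six bounds is exactly what one
of the constraints on `a`, `b`, `c` needs. -/
theorem exists_optimal_waterfilling {p r12 r13 r23 s1 s2 s3 t1 t2 t3 : ℝ}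
    (h12 : p ≤ r12) (h13 : p ≤ r13) (h23 : p ≤ r23) (h121 : r12 ≤ s1) (h122 : r12 ≤ s2)
    (h131 : r13 ≤ s1) (h133 : r13 ≤ s3) (h232 : r23 ≤ s2) (h233 : r23 ≤ s3)
    (h1 : s1 ≤ t1) (h2 : s2 ≤ t2) (h3 : s3 ≤ t3) :
    ∃ a b c l : ℝ, 0 ≤ a ∧ 0 ≤ b ∧ 0 ≤ c ∧ 0 ≤ l ∧ a + p ≤ r12 ∧ b + p ≤ r13 ∧ c + p ≤ r23 ∧
      a + b + p ≤ s1 ∧ a + c + p ≤ s2 ∧ b + c + p ≤ s3 ∧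
      l + a + b + p ≤ t1 ∧ l + a + c + p ≤ t2 ∧ l + b + c + p ≤ t3 ∧
      ∀ G : ℝ, G ≤ t1 + r23 → G ≤ t2 + r13 → G ≤ t3 + r12 → 2 * G ≤ t1 + t2 + s3 + p →
        2 * G ≤ t1 + t3 + s2 + p → 2 * G ≤ t2 + t3 + s1 + p → G ≤ 2 * p + a + b + c + l := by
  obtain ⟨G, ⟨g1, g2, g3, g4, g5, g6⟩, hG⟩ : ∃ G : ℝ, (G ≤ t1 + r23 ∧ G ≤ t2 + r13 ∧
      G ≤ t3 + r12 ∧ 2 * G ≤ t1 + t2 + s3 + p ∧ 2 * G ≤ t1 + t3 + s2 + p ∧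
      2 * G ≤ t2 + t3 + s1 + p) ∧ ∀ G' : ℝ, G' ≤ t1 + r23 → G' ≤ t2 + r13 → G' ≤ t3 + r12 →
      2 * G' ≤ t1 + t2 + s3 + p → 2 * G' ≤ t1 + t3 + s2 + p → 2 * G' ≤ t2 + t3 + s1 + p →
      G' ≤ G := by
    have hne : ({t1 + r23, t2 + r13, t3 + r12, (t1 + t2 + s3 + p) / 2, (t1 + t3 + s2 + p) / 2,
      (t2 + t3 + s1 + p) / 2} : Finset ℝ).Nonempty := ⟨t1 + r23, by simp⟩
    refine ⟨Finset.min' _ hne, ⟨?_, ?_, ?_, ?_, ?_, ?_⟩, ?_⟩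
    · exact Finset.min'_le _ _ (by simp)
    · exact Finset.min'_le _ _ (by simp)
    · exact Finset.min'_le _ _ (by simp)
    · have h := Finset.min'_le ({t1 + r23, t2 + r13, t3 + r12, (t1 + t2 + s3 + p) / 2,
        (t1 + t3 + s2 + p) / 2, (t2 + t3 + s1 + p) / 2} : Finset ℝ) ((t1 + t2 + s3 + p) / 2)
        (by simp)
      linarith
    · have h := Finset.min'_le ({t1 + r23, t2 + r13, t3 + r12, (t1 + t2 + s3 + p) / 2,
        (t1 + t3 + s2 + p) / 2, (t2 + t3 + s1 + p) / 2} : Finset ℝ) ((t1 + t3 + s2 + p) / 2)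
        (by simp)
      linarith
    · have h := Finset.min'_le ({t1 + r23, t2 + r13, t3 + r12, (t1 + t2 + s3 + p) / 2,
        (t1 + t3 + s2 + p) / 2, (t2 + t3 + s1 + p) / 2} : Finset ℝ) ((t2 + t3 + s1 + p) / 2)
        (by simp)
      linarith
    · intro G' k1 k2 k3 k4 k5 k6
      refine Finset.le_min' _ _ _ fun y hy => ?_
      simp only [Finset.mem_insert, Finset.mem_singleton] at hy
      rcases hy with rfl | rfl | rfl | rfl | rfl | rfl <;> linarith
  obtain ⟨a, ha0, ha1, ha2⟩ : ∃ a : ℝ, 0 ≤ a ∧ G - p - t3 ≤ a ∧ (a = 0 ∨ a = G - p - t3) :=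
    ⟨max 0 (G - p - t3), le_max_left _ _, le_max_right _ _, max_choice _ _⟩
  obtain ⟨b, hb0, hb1, hb2⟩ : ∃ b : ℝ, 0 ≤ b ∧ G - p - t2 ≤ b ∧ (b = 0 ∨ b = G - p - t2) :=
    ⟨max 0 (G - p - t2), le_max_left _ _, le_max_right _ _, max_choice _ _⟩
  obtain ⟨c, hc0, hc1, hc2⟩ : ∃ c : ℝ, 0 ≤ c ∧ G - p - t1 ≤ c ∧ (c = 0 ∨ c = G - p - t1) :=
    ⟨max 0 (G - p - t1), le_max_left _ _, le_max_right _ _, max_choice _ _⟩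
  have hab : a + b + p ≤ s1 := by
    rcases ha2 with rfl | rfl <;> rcases hb2 with rfl | rfl <;> linarith
  have hac : a + c + p ≤ s2 := by
    rcases ha2 with rfl | rfl <;> rcases hc2 with rfl | rfl <;> linarith
  have hbc : b + c + p ≤ s3 := by
    rcases hb2 with rfl | rfl <;> rcases hc2 with rfl | rfl <;> linarith
  obtain ⟨l, hl0, hl1, hl2⟩ : ∃ l : ℝ, 0 ≤ l ∧ G - 2 * p - a - b - c ≤ l ∧
      (l = 0 ∨ l = G - 2 * p - a - b - c) :=
    ⟨max 0 (G - 2 * p - a - b - c), le_max_left _ _, le_max_right _ _, max_choice _ _⟩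
  refine ⟨a, b, c, l, ha0, hb0, hc0, hl0, ?_, ?_, ?_, hab, hac, hbc, ?_, ?_, ?_, ?_⟩
  · rcases ha2 with rfl | rfl <;> linarith
  · rcases hb2 with rfl | rfl <;> linarith
  · rcases hc2 with rfl | rfl <;> linarith
  · rcases hl2 with rfl | rfl <;> linarith
  · rcases hl2 with rfl | rfl <;> linarith
  · rcases hl2 with rfl | rfl <;> linarith
  · intro G' k1 k2 k3 k4 k5 k6
    have := hG G' k1 k2 k3 k4 k5 k6
    linarith

/-! ### Conditional rank and the inequalities behind the converse -/

section Rank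

variable {F : Type u} [Field F] {d : ℕ}

theorem condRank_nonneg (A B : Submodule F (Fin d → F)) : 0 ≤ condRank A B := by
  have : finrank F B ≤ finrank F ↥(A ⊔ B) := Submodule.finrank_mono le_sup_right
  have : (finrank F B : ℝ) ≤ finrank F ↥(A ⊔ B) := by exact_mod_cast this
  unfold condRank; linarith

theorem condRank_mono {A A' : Submodule F (Fin d → F)} (h : A ≤ A') (B : Submodule F (Fin d → F)) :
    condRank A B ≤ condRank A' B := by
  have : finrank F ↥(A ⊔ B) ≤ finrank F ↥(A' ⊔ B) :=
    Submodule.finrank_mono (sup_le_sup_right h B)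
  have : (finrank F ↥(A ⊔ B) : ℝ) ≤ finrank F ↥(A' ⊔ B) := by exact_mod_cast this
  unfold condRank; linarith

/-- The rank gained by enlarging `A` to `U` in the presence of `C`. -/
theorem finrank_sup_sub_finrank_sup {A U : Submodule F (Fin d → F)} (hAU : A ≤ U)
    (C : Submodule F (Fin d → F)) :
    (finrank F ↥(C ⊔ U) : ℝ) - finrank F ↥(C ⊔ A)
      = finrank F U - finrank F A - condRank (U ⊓ C) A := by
  have h1 := Submodule.finrank_sup_add_finrank_inf_eq (C ⊔ A) U
  have h2 : C ⊔ A ⊔ U = C ⊔ U := by rw [sup_assoc, sup_eq_right.2 hAU]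
  have h3 : (C ⊔ A) ⊓ U = U ⊓ C ⊔ A := by
    rw [sup_comm, sup_inf_assoc_of_le _ hAU, sup_comm, inf_comm]
  rw [h2, h3] at h1
  have h4 : (finrank F ↥(C ⊔ U) : ℝ) + finrank F ↥(U ⊓ C ⊔ A)
      = finrank F ↥(C ⊔ A) + finrank F U := by exact_mod_cast h1
  unfold condRank; linarith

variable {A U : Fin 3 → Submodule F (Fin d → F)} {h : Submodule F (Fin d → F) → ℝ}

theorem condRank_bot_left (A : Submodule F (Fin d → F)) : condRank ⊥ A = 0 := by
  rw [condRank, bot_sup_eq, sub_self]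

/-- The bound from serving the users in the order `j`, `k`, `i`. -/
theorem sequential_bound (hAU : ∀ k, A k ≤ U k) (hnn : ∀ C, 0 ≤ h C)
    (hstep : ∀ k C, h (C ⊔ U k) + (finrank F ↥(C ⊔ U k) - finrank F ↥(C ⊔ A k)) ≤ h C)
    (i j k : Fin 3) :
    ((finrank F (U i) : ℝ) - finrank F (A i)) + (finrank F (U j) - finrank F (A j))
      + (finrank F (U k) - finrank F (A k)) - condRank (U j ⊓ U k) (A k)
      - condRank (U i ⊓ (U j ⊔ U k)) (A i) ≤ h ⊥ := by
  have h1 := hstep j ⊥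
  have h2 := hstep k (U j)
  have h3 := hstep i (U j ⊔ U k)
  rw [finrank_sup_sub_finrank_sup (hAU _)] at h1 h2 h3
  rw [bot_sup_eq, inf_bot_eq, condRank_bot_left] at h1
  rw [inf_comm] at h2
  have h4 := hnn (U j ⊔ U k ⊔ U i)
  linarith

/-- The bound from functional submodularity at `U i` and `U j`, with user `k` served twice. -/
theorem submodular_bound (hAU : ∀ k, A k ≤ U k) (hnn : ∀ C, 0 ≤ h C)
    (hstep : ∀ k C, h (C ⊔ U k) + (finrank F ↥(C ⊔ U k) - finrank F ↥(C ⊔ A k)) ≤ h C)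
    (hsub : ∀ B C, h (B ⊔ C) + h (B ⊓ C) ≤ h B + h C) (i j k : Fin 3) :
    2 * (((finrank F (U i) : ℝ) - finrank F (A i)) + (finrank F (U j) - finrank F (A j))
      + (finrank F (U k) - finrank F (A k))) - condRank (U i ⊓ (U j ⊔ U k)) (A i)
      - condRank (U j ⊓ (U i ⊔ U k)) (A j) - condRank (U i ⊓ U k ⊔ U j ⊓ U k) (A k)
      - condRank (U i ⊓ U j ⊓ U k) (A k) ≤ 2 * h ⊥ := by
  have h1 := hstep i ⊥
  have h2 := hstep j ⊥
  have h3 := hsub (U k) (U j)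
  have h4 := hsub (U k ⊓ U j) (U i)
  -- User `k` is served once starting from the triple intersection and once starting from `U k ⊓ U j
  -- ⊔ U i`. The two starting points are supplied by `h4`, and `h3` absorbs the resulting `h (U k)`.
  have h5 := hstep k (U k ⊓ U j ⊓ U i)
  have h6 := hstep k (U k ⊓ U j ⊔ U i)
  have h7 := hstep i (U k ⊔ U j)
  have h8 := hstep j (U i ⊔ U k)
  rw [finrank_sup_sub_finrank_sup (hAU _)] at h1 h2 h5 h6 h7 h8
  rw [bot_sup_eq, inf_bot_eq, condRank_bot_left] at h1 h2
  have e1 : U k ⊓ U j ⊓ U i ⊔ U k = U k := sup_eq_right.2 (inf_le_left.trans inf_le_left)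
  have e2 : U k ⊓ (U k ⊓ U j ⊓ U i) = U i ⊓ U j ⊓ U k := by
    rw [inf_eq_right.2 (inf_le_left.trans inf_le_left), inf_comm, inf_comm (U k), inf_assoc]
  have e3 : U k ⊓ U j ⊔ U i ⊔ U k = U i ⊔ U k := by
    rw [sup_assoc]; exact sup_eq_right.2 (inf_le_left.trans le_sup_right)
  have e4 : U k ⊓ (U k ⊓ U j ⊔ U i) = U i ⊓ U k ⊔ U j ⊓ U k := by
    rw [inf_comm, sup_inf_assoc_of_le _ inf_le_left, sup_comm, inf_comm (U k)]
  rw [e1, e2] at h5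
  rw [e3, e4] at h6
  rw [sup_comm (U k) (U j)] at h3 h7
  have h9 := hnn (U j ⊔ U k ⊔ U i)
  have h10 := hnn (U i ⊔ U k ⊔ U j)
  linarith

/-- The bound from functional submodularity at `U j` and `U k`, with user `i` served twice. -/
theorem submodular_bound' (hAU : ∀ k, A k ≤ U k) (hnn : ∀ C, 0 ≤ h C)
    (hstep : ∀ k C, h (C ⊔ U k) + (finrank F ↥(C ⊔ U k) - finrank F ↥(C ⊔ A k)) ≤ h C)
    (hsub : ∀ B C, h (B ⊔ C) + h (B ⊓ C) ≤ h B + h C) (i j k : Fin 3) :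
    2 * (((finrank F (U i) : ℝ) - finrank F (A i)) + (finrank F (U j) - finrank F (A j))
      + (finrank F (U k) - finrank F (A k))) - condRank (U i ⊓ (U j ⊔ U k)) (A i)
      - condRank (U j ⊓ (U i ⊔ U k)) (A j) - condRank (U i ⊓ U k ⊔ U j ⊓ U k) (A k)
      - condRank (U i ⊓ U j ⊓ U k) (A i) ≤ 2 * h ⊥ := by
  have h1 := hstep j ⊥
  have h2 := hstep k ⊥
  have h3 := hsub (U k) (U j)
  -- Serving user `i` from `U k ⊓ U j`, rather than applying submodularity again there, charges the
  -- triple intersection to `A i` instead of `A k`.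
  have h5 := hstep i (U k ⊓ U j)
  have h6 := hstep k (U k ⊓ U j ⊔ U i)
  have h7 := hstep i (U k ⊔ U j)
  have h8 := hstep j (U i ⊔ U k)
  rw [finrank_sup_sub_finrank_sup (hAU _)] at h1 h2 h5 h6 h7 h8
  rw [bot_sup_eq, inf_bot_eq, condRank_bot_left] at h1 h2
  have e2 : U i ⊓ (U k ⊓ U j) = U i ⊓ U j ⊓ U k := by
    rw [inf_comm (U k), inf_assoc]
  have e3 : U k ⊓ U j ⊔ U i ⊔ U k = U i ⊔ U k := by
    rw [sup_assoc]; exact sup_eq_right.2 (inf_le_left.trans le_sup_right)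
  have e4 : U k ⊓ (U k ⊓ U j ⊔ U i) = U i ⊓ U k ⊔ U j ⊓ U k := by
    rw [inf_comm, sup_inf_assoc_of_le _ inf_le_left, sup_comm, inf_comm (U k)]
  rw [e2] at h5
  rw [e3, e4] at h6
  rw [sup_comm (U k) (U j)] at h3 h7
  have h9 := hnn (U j ⊔ U k ⊔ U i)
  have h10 := hnn (U i ⊔ U k ⊔ U j)
  linarith

end Rank

/-! ### Bounds on the gain and optimality for the linear program -/

namespace LCBC

variable {F : Type u} [Field F] {d : ℕ}

/-- The upper bounds on the gain `2λ₁₂₃ + λ₁₂ + λ₁₃ + λ₂₃ + λ` from the vertices of the dual of the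
linear program. -/
structure GainBounds (P : LCBC F 3 d) (G : ℝ) : Prop where
  b1_2 : G ≤ condRank (P.UParen 0 1 2) (P.sideSpace 0) + condRank (P.U₂ 1 2) (P.sideSpace 1)
  b1_3 : G ≤ condRank (P.UParen 0 1 2) (P.sideSpace 0) + condRank (P.U₂ 1 2) (P.sideSpace 2)
  b2_1 : G ≤ condRank (P.UParen 1 0 2) (P.sideSpace 1) + condRank (P.U₂ 0 2) (P.sideSpace 0)
  b2_3 : G ≤ condRank (P.UParen 1 0 2) (P.sideSpace 1) + condRank (P.U₂ 0 2) (P.sideSpace 2)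
  b3_1 : G ≤ condRank (P.UParen 2 0 1) (P.sideSpace 2) + condRank (P.U₂ 0 1) (P.sideSpace 0)
  b3_2 : G ≤ condRank (P.UParen 2 0 1) (P.sideSpace 2) + condRank (P.U₂ 0 1) (P.sideSpace 1)
  b12 : ∀ m, 2 * G ≤ condRank (P.UParen 0 1 2) (P.sideSpace 0)
    + condRank (P.UParen 1 0 2) (P.sideSpace 1)
    + condRank (P.U₂ 0 2 ⊔ P.U₂ 1 2) (P.sideSpace 2) + condRank (P.U₃ 0 1 2) (P.sideSpace m)
  b13 : ∀ m, 2 * G ≤ condRank (P.UParen 0 1 2) (P.sideSpace 0)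
    + condRank (P.UParen 2 0 1) (P.sideSpace 2)
    + condRank (P.U₂ 0 1 ⊔ P.U₂ 1 2) (P.sideSpace 1) + condRank (P.U₃ 0 1 2) (P.sideSpace m)
  b23 : ∀ m, 2 * G ≤ condRank (P.UParen 1 0 2) (P.sideSpace 1)
    + condRank (P.UParen 2 0 1) (P.sideSpace 2)
    + condRank (P.U₂ 0 1 ⊔ P.U₂ 0 2) (P.sideSpace 0) + condRank (P.U₃ 0 1 2) (P.sideSpace m)

/-- Weak duality: the gain, or twice the gain, is exactly the sum of the left-hand sides of the
constraints whose right-hand sides appear in the bound. -/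
theorem LPFeasible.gainBounds {P : LCBC F 3 d} {x : LPVars} (hx : P.LPFeasible x) :
    P.GainBounds (2 * x.l123 + x.l12 + x.l13 + x.l23 + x.l) := by
  obtain ⟨n1, n2, n3, n4, n5, c1, c2, c3, c4, c5, c6, c7, c8, c9, c10, c11, c12, c13, c14, c15⟩ := hx
  have hm : ∀ m, x.l123 ≤ condRank (P.U₃ 0 1 2) (P.sideSpace m) := by
    intro m; fin_cases m <;> assumption
  constructor
  all_goals first | (intro m; have := hm m; linarith) | linarith

/-- `λ₁₂₃` is set to its largest value allowed by the three triple constraints. Each pair constraint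
keeps the smaller of its two users' ranks, and the other variables come from the explicit solution.
-/
theorem exists_lp_optimal (P : LCBC F 3 d) :
    ∃ x, P.LPFeasible x ∧
      ∀ G, P.GainBounds G → G ≤ 2 * x.l123 + x.l12 + x.l13 + x.l23 + x.l := by
  have u12 : P.U₃ 0 1 2 ≤ P.U₂ 0 1 := inf_le_left
  have u13 : P.U₃ 0 1 2 ≤ P.U₂ 0 2 := le_inf (inf_le_left.trans inf_le_left) inf_le_right
  have u23 : P.U₃ 0 1 2 ≤ P.U₂ 1 2 := le_inf (inf_le_left.trans inf_le_right) inf_le_right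
  have v1 : P.U₂ 0 1 ⊔ P.U₂ 0 2 ≤ P.UParen 0 1 2 :=
    sup_le (inf_le_inf_left _ le_sup_left) (inf_le_inf_left _ le_sup_right)
  have v2 : P.U₂ 0 1 ⊔ P.U₂ 1 2 ≤ P.UParen 1 0 2 :=
    sup_le (le_inf inf_le_right (inf_le_left.trans le_sup_left))
      (inf_le_inf_left _ le_sup_right)
  have v3 : P.U₂ 0 2 ⊔ P.U₂ 1 2 ≤ P.UParen 2 0 1 :=
    sup_le (le_inf inf_le_right (inf_le_left.trans le_sup_left))
      (le_inf inf_le_right (inf_le_left.trans le_sup_right))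
  let p : Fin 3 → ℝ := fun m => condRank (P.U₃ 0 1 2) (P.sideSpace m)
  obtain ⟨m, hm⟩ := Finite.exists_min p
  have q12 : p m ≤ min (condRank (P.U₂ 0 1) (P.sideSpace 0)) (condRank (P.U₂ 0 1) (P.sideSpace 1)) :=
    le_min ((hm 0).trans (condRank_mono u12 _)) ((hm 1).trans (condRank_mono u12 _))
  have q13 : p m ≤ min (condRank (P.U₂ 0 2) (P.sideSpace 0)) (condRank (P.U₂ 0 2) (P.sideSpace 2)) :=
    le_min ((hm 0).trans (condRank_mono u13 _)) ((hm 2).trans (condRank_mono u13 _))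
  have q23 : p m ≤ min (condRank (P.U₂ 1 2) (P.sideSpace 1)) (condRank (P.U₂ 1 2) (P.sideSpace 2)) :=
    le_min ((hm 1).trans (condRank_mono u23 _)) ((hm 2).trans (condRank_mono u23 _))
  obtain ⟨a, b, c, l, ha, hb, hc, hl, k1, k2, k3, k4, k5, k6, k7, k8, k9, hopt⟩ :=
    exists_optimal_waterfilling q12 q13 q23
      ((min_le_left _ _).trans (condRank_mono le_sup_left _))
      ((min_le_right _ _).trans (condRank_mono le_sup_left _))
      ((min_le_left _ _).trans (condRank_mono le_sup_right _))
      ((min_le_right _ _).trans (condRank_mono le_sup_left _))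
      ((min_le_left _ _).trans (condRank_mono le_sup_right _))
      ((min_le_right _ _).trans (condRank_mono le_sup_right _))
      (condRank_mono v1 (P.sideSpace 0)) (condRank_mono v2 (P.sideSpace 1))
      (condRank_mono v3 (P.sideSpace 2))
  refine ⟨⟨p m, a, b, c, l⟩, ⟨condRank_nonneg _ _, ha, hb, hc, hl, hm 0, hm 1, hm 2,
    k1.trans (min_le_left _ _), k1.trans (min_le_right _ _), k2.trans (min_le_left _ _),
    k2.trans (min_le_right _ _), k3.trans (min_le_left _ _), k3.trans (min_le_right _ _),
    k4, k5, k6, k7, k8, k9⟩, fun G hG => ?_⟩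
  refine hopt G ?_ ?_ ?_ (hG.b12 m) (hG.b13 m) (hG.b23 m)
  · rcases min_choice (condRank (P.U₂ 1 2) (P.sideSpace 1)) (condRank (P.U₂ 1 2) (P.sideSpace 2))
      with h | h <;> rw [h]
    exacts [hG.b1_2, hG.b1_3]
  · rcases min_choice (condRank (P.U₂ 0 2) (P.sideSpace 0)) (condRank (P.U₂ 0 2) (P.sideSpace 2))
      with h | h <;> rw [h]
    exacts [hG.b2_1, hG.b2_3]
  · rcases min_choice (condRank (P.U₂ 0 1) (P.sideSpace 0)) (condRank (P.U₂ 0 1) (P.sideSpace 1))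
      with h | h <;> rw [h]
    exacts [hG.b3_1, hG.b3_2]

theorem U_eq_sup {K : ℕ} (P : LCBC F K d) (k : Fin K) : P.U k = P.sideSpace k ⊔ colSpan (P.V k) :=
  colSpan_fromCols _ _

theorem sideSpace_le_U {K : ℕ} (P : LCBC F K d) (k : Fin K) : P.sideSpace k ≤ P.U k :=
  P.U_eq_sup k ▸ le_sup_left

theorem lpObjective_eq (P : LCBC F 3 d) (x : LPVars) :
    P.lpObjective x = ((finrank F (P.U 0) : ℝ) - finrank F (P.sideSpace 0))
      + (finrank F (P.U 1) - finrank F (P.sideSpace 1))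
      + (finrank F (P.U 2) - finrank F (P.sideSpace 2))
      - (2 * x.l123 + x.l12 + x.l13 + x.l23 + x.l) := by
  have h : ∀ k, condRank (colSpan (P.V k)) (P.sideSpace k)
      = finrank F (P.U k) - finrank F (P.sideSpace k) := fun k => by
    rw [condRank, sup_comm, ← U_eq_sup]
  rw [lpObjective, h, h, h]; ring

/-- The converse of the linear program: every functional with the properties of a normalized
conditional entropy dominates the linear program at `⊥`. -/
theorem gainBounds_of_submodular (P : LCBC F 3 d) {h : Submodule F (Fin d → F) → ℝ}
    (hnn : ∀ C, 0 ≤ h C)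
    (hstep : ∀ k C, h (C ⊔ P.U k) + (finrank F ↥(C ⊔ P.U k) - finrank F ↥(C ⊔ P.sideSpace k)) ≤ h C)
    (hsub : ∀ B C, h (B ⊔ C) + h (B ⊓ C) ≤ h B + h C) :
    P.GainBounds (((finrank F (P.U 0) : ℝ) - finrank F (P.sideSpace 0))
      + (finrank F (P.U 1) - finrank F (P.sideSpace 1))
      + (finrank F (P.U 2) - finrank F (P.sideSpace 2)) - h ⊥) := by
  have hseq := sequential_bound P.sideSpace_le_U hnn hstep
  have hs := submodular_bound P.sideSpace_le_U hnn hstep hsub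
  have hs' := submodular_bound' P.sideSpace_le_U hnn hstep hsub
  have c10 : P.U 1 ⊓ P.U 0 = P.U 0 ⊓ P.U 1 := inf_comm _ _
  have c20 : P.U 2 ⊓ P.U 0 = P.U 0 ⊓ P.U 2 := inf_comm _ _
  have c21 : P.U 2 ⊓ P.U 1 = P.U 1 ⊓ P.U 2 := inf_comm _ _
  have s10 : P.U 1 ⊔ P.U 0 = P.U 0 ⊔ P.U 1 := sup_comm _ _
  have s20 : P.U 2 ⊔ P.U 0 = P.U 0 ⊔ P.U 2 := sup_comm _ _
  have s21 : P.U 2 ⊔ P.U 1 = P.U 1 ⊔ P.U 2 := sup_comm _ _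
  have d1 : P.U 0 ⊓ P.U 2 ⊓ P.U 1 = P.U 0 ⊓ P.U 1 ⊓ P.U 2 := inf_right_comm _ _ _
  have d2 : P.U 1 ⊓ P.U 2 ⊓ P.U 0 = P.U 0 ⊓ P.U 1 ⊓ P.U 2 := by
    rw [inf_right_comm, c10]
  constructor
  · have := hseq 0 2 1
    simp only [U₂, UParen, c21, s21] at this ⊢; linarith
  · have := hseq 0 1 2
    simp only [U₂, UParen] at this ⊢; linarith
  · have := hseq 1 2 0
    simp only [U₂, UParen, c20, s20] at this ⊢; linarith
  · have := hseq 1 0 2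
    simp only [U₂, UParen] at this ⊢; linarith
  · have := hseq 2 1 0
    simp only [U₂, UParen, c10, s10] at this ⊢; linarith
  · have := hseq 2 0 1
    simp only [U₂, UParen] at this ⊢; linarith
  -- The triple intersection has to be charged to each user `m` in turn: `hs` charges it to its
  -- third user, and `hs'` to its first, which may be either of the other two.
  · intro m
    fin_cases m
    · have := hs' 0 1 2
      simp only [U₂, U₃, UParen, Fin.zero_eta] at this ⊢; linarith
    · have := hs' 1 0 2
      simp only [U₂, U₃, UParen, Fin.mk_one, c10] at this ⊢
      rw [sup_comm (P.U 1 ⊓ P.U 2)] at this; linarith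
    · have := hs 0 1 2
      simp only [U₂, U₃, UParen, Fin.reduceFinMk] at this ⊢; linarith
  · intro m
    fin_cases m
    · have := hs' 0 2 1
      simp only [U₂, U₃, UParen, Fin.zero_eta, c21, s21, d1] at this ⊢; linarith
    · have := hs 0 2 1
      simp only [U₂, U₃, UParen, Fin.mk_one, c21, s21, d1] at this ⊢; linarith
    · have := hs' 2 0 1
      simp only [U₂, U₃, UParen, Fin.reduceFinMk, c21, c20, s21, d1] at this ⊢
      rw [sup_comm (P.U 1 ⊓ P.U 2)] at this; linarith
  · intro m
    fin_cases m
    · have := hs 1 2 0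
      simp only [U₂, U₃, UParen, Fin.zero_eta, c10, c20, s20, s10, d2] at this ⊢; linarith
    · have := hs' 1 2 0
      simp only [U₂, U₃, UParen, Fin.mk_one, c10, c20, s20, s10, d2] at this ⊢; linarith
    · have := hs' 2 1 0
      simp only [U₂, U₃, UParen, Fin.reduceFinMk, c10, c20, c21, s20, s10, d2] at this ⊢
      rw [sup_comm (P.U 0 ⊓ P.U 2)] at this; linarith

end LCBC

/-! ### Entropy of uniform data through sizes of equivalence classes -/

section Entropy

variable {Ω : Type*} [Fintype Ω]

open Classical in
/-- The number of elements equivalent to `ω`. -/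
noncomputable def classCard (r : Setoid Ω) (ω : Ω) : ℕ := (Finset.univ.filter fun x => r ω x).card

/-- `∑ ω, log |[ω]|`: up to affine normalisation, minus the entropy of the class of a uniformly
distributed element. -/
noncomputable def logClassSum (r : Setoid Ω) : ℝ := ∑ ω, Real.log (classCard r ω)

theorem classCard_pos (r : Setoid Ω) (ω : Ω) : 0 < classCard r ω := by
  classical
  exact Finset.card_pos.2 ⟨ω, by simp⟩

theorem classCard_eq_of_rel {r : Setoid Ω} {x y : Ω} (h : r x y) :
    classCard r x = classCard r y := by
  classical
  unfold classCard
  congr 1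
  ext z
  simp only [Finset.mem_filter, Finset.mem_univ, true_and]
  exact ⟨fun hz => r.trans (r.symm h) hz, fun hz => r.trans h hz⟩

theorem classCard_mono {r r' : Setoid Ω} (h : r ≤ r') (ω : Ω) : classCard r ω ≤ classCard r' ω := by
  classical
  refine Finset.card_le_card fun x hx => ?_
  simp only [Finset.mem_filter, Finset.mem_univ, true_and] at hx ⊢
  exact h hx

theorem logClassSum_mono {r r' : Setoid Ω} (h : r ≤ r') : logClassSum r ≤ logClassSum r' :=
  Finset.sum_le_sum fun ω _ => Real.log_le_log (by exact_mod_cast classCard_pos r ω)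
    (by exact_mod_cast classCard_mono h ω)

theorem sum_inv_classCard_le_one (r : Setoid Ω) (s : Finset Ω)
    (hs : ∀ x ∈ s, ∀ y ∈ s, r x y) : ∑ ω ∈ s, ((classCard r ω : ℝ))⁻¹ ≤ 1 := by
  classical
  rcases s.eq_empty_or_nonempty with rfl | ⟨x, hx⟩
  · simp
  · have h1 : ∀ ω ∈ s, ((classCard r ω : ℝ))⁻¹ = (classCard r x : ℝ)⁻¹ := fun ω hω => by
      rw [classCard_eq_of_rel (hs ω hω x hx)]
    rw [Finset.sum_congr rfl h1, Finset.sum_const, nsmul_eq_mul]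
    have h2 : s.card ≤ classCard r x := by
      refine Finset.card_le_card fun y hy => ?_
      simp only [Finset.mem_filter, Finset.mem_univ, true_and]
      exact hs x hx y hy
    have h3 : (0 : ℝ) < classCard r x := by exact_mod_cast classCard_pos r x
    rw [← div_eq_mul_inv, div_le_one h3]
    exact_mod_cast h2

/-- Functional submodularity of entropy. -/
theorem logClassSum_add_le {r₀ r₁ r₂ : Setoid Ω} (h₁ : r₁ ≤ r₀) (h₂ : r₂ ≤ r₀) :
    logClassSum r₁ + logClassSum r₂ ≤ logClassSum (r₁ ⊓ r₂) + logClassSum r₀ := by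
  classical
  have pos : ∀ (r : Setoid Ω) ω, (0 : ℝ) < classCard r ω := fun r ω => by
    exact_mod_cast classCard_pos r ω
  have hlog : ∀ ω, Real.log (classCard r₁ ω) + Real.log (classCard r₂ ω)
      - Real.log (classCard (r₁ ⊓ r₂) ω) - Real.log (classCard r₀ ω)
      ≤ classCard r₁ ω * classCard r₂ ω
        * ((classCard (r₁ ⊓ r₂) ω : ℝ)⁻¹ * (classCard r₀ ω : ℝ)⁻¹) - 1 := by
    intro ω
    have p1 := pos r₁ ω
    have p2 := pos r₂ ω
    have p3 := pos (r₁ ⊓ r₂) ω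
    have p4 := pos r₀ ω
    refine le_trans (le_of_eq ?_) (Real.log_le_sub_one_of_pos (by positivity))
    rw [Real.log_mul (by positivity) (by positivity), Real.log_mul p1.ne' p2.ne',
      Real.log_mul (by positivity) (by positivity), Real.log_inv, Real.log_inv]
    ring
  -- Double counting: expand the product as a sum over `x` in the `r₁`-class and `y` in the
  -- `r₂`-class of `ω`. For fixed `x, y`, the possible `ω` lie in a single class of `r₁ ⊓ r₂`, so
  -- their inverse class sizes sum to at most 1. They exist only if `r₀ x y`, and summing
  -- `(classCard r₀ x)⁻¹` over such `y` gives 1.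
  have hsum : ∑ ω, (classCard r₁ ω * classCard r₂ ω
        * ((classCard (r₁ ⊓ r₂) ω : ℝ)⁻¹ * (classCard r₀ ω : ℝ)⁻¹)) ≤ Fintype.card Ω := by
    have expand : ∀ ω, (classCard r₁ ω * classCard r₂ ω
        * ((classCard (r₁ ⊓ r₂) ω : ℝ)⁻¹ * (classCard r₀ ω : ℝ)⁻¹))
        = ∑ x, ∑ y, if r₁ ω x ∧ r₂ ω y then
            ((classCard (r₁ ⊓ r₂) ω : ℝ)⁻¹ * (classCard r₀ ω : ℝ)⁻¹) else 0 := by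
      intro ω
      have : ∀ r : Setoid Ω, (classCard r ω : ℝ) = ∑ x, if r ω x then (1 : ℝ) else 0 := fun r => by
        rw [classCard, Finset.card_filter]; push_cast; rfl
      rw [this r₁, this r₂, Finset.sum_mul_sum, Finset.sum_mul]
      refine Finset.sum_congr rfl fun x _ => ?_
      rw [Finset.sum_mul]
      refine Finset.sum_congr rfl fun y _ => ?_
      by_cases hx : r₁ ω x <;> by_cases hy : r₂ ω y <;> simp [hx, hy]
    rw [Finset.sum_congr rfl fun ω _ => expand ω, Finset.sum_comm]
    have hx : ∀ x, ∑ ω, ∑ y, (if r₁ ω x ∧ r₂ ω y then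
            ((classCard (r₁ ⊓ r₂) ω : ℝ)⁻¹ * (classCard r₀ ω : ℝ)⁻¹) else 0) ≤ 1 := by
      intro x
      rw [Finset.sum_comm]
      have hy : ∀ y, ∑ ω, (if r₁ ω x ∧ r₂ ω y then
            ((classCard (r₁ ⊓ r₂) ω : ℝ)⁻¹ * (classCard r₀ ω : ℝ)⁻¹) else 0)
            ≤ if r₀ x y then (classCard r₀ x : ℝ)⁻¹ else 0 := by
        intro y
        rw [← Finset.sum_filter]
        by_cases hxy : r₀ x y
        · rw [if_pos hxy]
          have h0 : ∀ ω ∈ Finset.univ.filter (fun ω => r₁ ω x ∧ r₂ ω y),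
              ((classCard (r₁ ⊓ r₂) ω : ℝ)⁻¹ * (classCard r₀ ω : ℝ)⁻¹)
              = (classCard (r₁ ⊓ r₂) ω : ℝ)⁻¹ * (classCard r₀ x : ℝ)⁻¹ := fun ω hω => by
            rw [classCard_eq_of_rel (h₁ (Finset.mem_filter.1 hω).2.1)]
          rw [Finset.sum_congr rfl h0, ← Finset.sum_mul]
          refine mul_le_of_le_one_left (by have := pos r₀ x; positivity)
            (sum_inv_classCard_le_one _ _ ?_)
          intro a ha b hb
          have ha := (Finset.mem_filter.1 ha).2
          have hb := (Finset.mem_filter.1 hb).2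
          exact ⟨r₁.trans ha.1 (r₁.symm hb.1), r₂.trans ha.2 (r₂.symm hb.2)⟩
        · rw [if_neg hxy, Finset.filter_false_of_mem, Finset.sum_empty]
          rintro ω - ⟨ha, hb⟩
          exact hxy (r₀.trans (r₀.symm (h₁ ha)) (h₂ hb))
      refine (Finset.sum_le_sum fun y _ => hy y).trans ?_
      rw [← Finset.sum_filter, Finset.sum_const, nsmul_eq_mul]
      exact le_of_eq (mul_inv_cancel₀ (pos r₀ x).ne')
    refine (Finset.sum_le_sum fun x _ => hx x).trans ?_
    simp
  have := Finset.sum_le_sum fun ω (_ : ω ∈ Finset.univ) => hlog ω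
  simp only [Finset.sum_sub_distrib, Finset.sum_add_distrib, Finset.sum_const, Finset.card_univ,
    nsmul_eq_mul, mul_one] at this
  unfold logClassSum
  linarith

/-- The entropy of a function is at most the logarithm of the size of its codomain. -/
theorem card_mul_log_le_logClassSum_ker {S : Type*} [Fintype S] (f : Ω → S) :
    Fintype.card Ω * (Real.log (Fintype.card Ω) - Real.log (Fintype.card S))
      ≤ logClassSum (Setoid.ker f) := by
  classical
  rcases isEmpty_or_nonempty Ω with hΩ | hΩ
  · simp [logClassSum]
  have hS : Nonempty S := hΩ.map f
  have p1 : (0 : ℝ) < Fintype.card Ω := by exact_mod_cast Fintype.card_pos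
  have p2 : (0 : ℝ) < Fintype.card S := by exact_mod_cast Fintype.card_pos
  have hlog : ∀ ω, Real.log (Fintype.card Ω) - Real.log (Fintype.card S)
      - Real.log (classCard (Setoid.ker f) ω)
      ≤ Fintype.card Ω * (Fintype.card S : ℝ)⁻¹ * (classCard (Setoid.ker f) ω : ℝ)⁻¹ - 1 := by
    intro ω
    have p3 : (0 : ℝ) < classCard (Setoid.ker f) ω := by exact_mod_cast classCard_pos _ ω
    refine le_trans (le_of_eq ?_) (Real.log_le_sub_one_of_pos (by positivity))
    rw [Real.log_mul (by positivity) (by positivity), Real.log_mul p1.ne' (by positivity),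
      Real.log_inv, Real.log_inv]
    ring
  have hsum : ∑ ω, (classCard (Setoid.ker f) ω : ℝ)⁻¹ ≤ Fintype.card S := by
    rw [← Finset.sum_fiberwise Finset.univ f]
    refine (Finset.sum_le_sum fun s _ => sum_inv_classCard_le_one _ _ ?_).trans (by simp)
    intro x hx y hy
    exact (Finset.mem_filter.1 hx).2.trans (Finset.mem_filter.1 hy).2.symm
  have h := Finset.sum_le_sum fun ω (_ : ω ∈ Finset.univ) => hlog ω
  simp only [Finset.sum_sub_distrib, Finset.sum_const, Finset.card_univ,
    nsmul_eq_mul, mul_one, ← Finset.mul_sum] at h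
  have h2 : (Fintype.card Ω : ℝ) * (Fintype.card S : ℝ)⁻¹ *
      ∑ ω, (classCard (Setoid.ker f) ω : ℝ)⁻¹ ≤ Fintype.card Ω := by
    calc _ ≤ (Fintype.card Ω : ℝ) * (Fintype.card S : ℝ)⁻¹ * Fintype.card S :=
          mul_le_mul_of_nonneg_left hsum (by positivity)
      _ = _ := by field_simp
  unfold logClassSum
  linarith

end Entropy

/-! ### Conditional entropy of the broadcast as a function of a subspace -/

section ConditionalEntropy

variable {F W S : Type*} [Field F] [AddCommGroup W] [Module F W] {L : ℕ}

/-- Tuples of functionals that agree on `C`. -/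
def agreeSetoid (L : ℕ) (C : Submodule F W) : Setoid (Fin L → Dual F W) where
  r φ ψ := ∀ i, ∀ w ∈ C, φ i w = ψ i w
  iseqv := ⟨fun _ _ _ _ => rfl, fun h i w hw => (h i w hw).symm,
    fun h h' i w hw => (h i w hw).trans (h' i w hw)⟩

theorem agreeSetoid_anti {B C : Submodule F W} (h : B ≤ C) : agreeSetoid L C ≤ agreeSetoid L B :=
  fun _ _ hφ i w hw => hφ i w (h hw)

theorem agreeSetoid_sup (B C : Submodule F W) :
    agreeSetoid L (B ⊔ C) = agreeSetoid L B ⊓ agreeSetoid L C := by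
  refine le_antisymm (le_inf (agreeSetoid_anti le_sup_left) (agreeSetoid_anti le_sup_right)) ?_
  rintro φ ψ ⟨h1, h2⟩ i w hw
  obtain ⟨x, hx, y, hy, rfl⟩ := Submodule.mem_sup.1 hw
  rw [map_add, map_add, h1 i x hx, h2 i y hy]

theorem agreeSetoid_bot : agreeSetoid L (⊥ : Submodule F W) = ⊤ := by
  refine top_le_iff.1 fun φ ψ _ i w hw => ?_
  rw [(Submodule.mem_bot F).1 hw, map_zero, map_zero]

variable [Fintype F] [Fintype (Dual F W)]

/-- The normalized conditional entropy `H(enc | C) / L` in `q`-ary units of an encoding of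
uniformly distributed data given its values on `C`. -/
noncomputable def condEntropy (enc : (Fin L → Dual F W) → S) (C : Submodule F W) : ℝ :=
  finrank F W - finrank F C - logClassSum (Setoid.ker enc ⊓ agreeSetoid L C)
    / (Fintype.card (Fin L → Dual F W) * (L * Real.log (Fintype.card F)))

theorem condEntropy_scale_pos (hL : 0 < L) :
    (0 : ℝ) < Fintype.card (Fin L → Dual F W) * (L * Real.log (Fintype.card F)) := by
  have h1 : (0 : ℝ) < Fintype.card (Fin L → Dual F W) := by exact_mod_cast Fintype.card_pos
  have h2 : 0 < Real.log (Fintype.card F) :=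
    Real.log_pos (by exact_mod_cast Fintype.one_lt_card)
  have h3 : (0 : ℝ) < L := by exact_mod_cast hL
  positivity

/-- The class of `φ` is the translate by `φ` of the `L`-tuples in the annihilator of `C`. -/
theorem classCard_agreeSetoid [FiniteDimensional F W] (C : Submodule F W) (φ : Fin L → Dual F W) :
    (classCard (agreeSetoid L C) φ) * Fintype.card F ^ (finrank F C * L)
      = Fintype.card F ^ (finrank F W * L) := by
  classical
  have h1 : classCard (agreeSetoid L C) φ = Fintype.card (Fin L → C.dualAnnihilator) := by
    rw [classCard, ← Fintype.card_subtype]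
    refine Fintype.card_congr
      { toFun := fun ψ i => ⟨ψ.1 i - φ i, (Submodule.mem_dualAnnihilator _).2 fun w hw => by
          rw [LinearMap.sub_apply, ← ψ.2 i w hw, sub_self]⟩
        invFun := fun χ => ⟨fun i => φ i + χ i, fun i w hw => by
          rw [LinearMap.add_apply, (Submodule.mem_dualAnnihilator _).1 (χ i).2 w hw, add_zero]⟩
        left_inv := fun ψ => by ext; simp
        right_inv := fun χ => by ext; simp }
  rw [h1, Fintype.card_fun, Module.card_eq_pow_finrank (K := F), Fintype.card_fin, ← pow_mul,
    ← pow_add, ← add_mul, add_comm (finrank F _), Subspace.finrank_add_finrank_dualAnnihilator_eq]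

theorem logClassSum_agreeSetoid [FiniteDimensional F W] (C : Submodule F W) :
    logClassSum (agreeSetoid L C) = Fintype.card (Fin L → Dual F W)
      * (L * Real.log (Fintype.card F) * (finrank F W - finrank F C)) := by
  have h : ∀ φ : Fin L → Dual F W, Real.log (classCard (agreeSetoid L C) φ)
      = L * Real.log (Fintype.card F) * (finrank F W - finrank F C) := by
    intro φ
    have h1 : (classCard (agreeSetoid L C) φ : ℝ) * (Fintype.card F : ℝ) ^ (finrank F C * L)
      = (Fintype.card F : ℝ) ^ (finrank F W * L) := by exact_mod_cast classCard_agreeSetoid C φ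
    have p1 : (0 : ℝ) < Fintype.card F := by exact_mod_cast Fintype.card_pos
    have p2 : (0 : ℝ) < classCard (agreeSetoid L C) φ := by exact_mod_cast classCard_pos _ _
    have h2 := congrArg Real.log h1
    rw [Real.log_mul p2.ne' (by positivity), Real.log_pow, Real.log_pow] at h2
    push_cast at h2
    linarith
  rw [logClassSum, Finset.sum_congr rfl fun φ _ => h φ, Finset.sum_const, nsmul_eq_mul,
    Finset.card_univ]

variable (enc : (Fin L → Dual F W) → S)

theorem condEntropy_nonneg [FiniteDimensional F W] (hL : 0 < L) (C : Submodule F W) : 0 ≤ condEntropy enc C := by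
  have h1 := logClassSum_mono (inf_le_right : Setoid.ker enc ⊓ agreeSetoid L C ≤ _)
  rw [logClassSum_agreeSetoid, ← mul_assoc] at h1
  rw [condEntropy, sub_nonneg, div_le_iff₀ (condEntropy_scale_pos hL)]
  linarith

/-- The values on `B ⊓ C` are a function of those on `B` and of those on `C`, so functional
submodularity applies. The rank terms cancel because dimension is modular. -/
theorem condEntropy_submodular [FiniteDimensional F W] (hL : 0 < L) (B C : Submodule F W) :
    condEntropy enc (B ⊔ C) + condEntropy enc (B ⊓ C) ≤ condEntropy enc B + condEntropy enc C := by
  have h1 := logClassSum_add_le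
    (inf_le_inf_left (Setoid.ker enc) (agreeSetoid_anti (L := L) (inf_le_left : B ⊓ C ≤ B)))
    (inf_le_inf_left (Setoid.ker enc) (agreeSetoid_anti (L := L) (inf_le_right : B ⊓ C ≤ C)))
  rw [← inf_inf_distrib_left, ← agreeSetoid_sup] at h1
  have h2 : (finrank F ↥(B ⊔ C) : ℝ) + finrank F ↥(B ⊓ C) = finrank F B + finrank F C := by
    exact_mod_cast Submodule.finrank_sup_add_finrank_inf_eq B C
  have h3 := div_le_div_of_nonneg_right h1 (condEntropy_scale_pos (F := F) (W := W) hL).le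
  rw [add_div, add_div] at h3
  unfold condEntropy
  linarith

/-- Conditioning reduces entropy: functional submodularity for the pair of the encoding with the
values on `B`, and the values on `C`, over the values on `B`. -/
theorem condEntropy_anti [FiniteDimensional F W] (hL : 0 < L) {B C : Submodule F W} (h : B ≤ C) :
    condEntropy enc C ≤ condEntropy enc B := by
  have h1 := logClassSum_add_le (r₀ := agreeSetoid L B) (r₁ := Setoid.ker enc ⊓ agreeSetoid L B)
    (r₂ := agreeSetoid L C) inf_le_right (agreeSetoid_anti h)
  rw [inf_assoc, inf_eq_right.2 (agreeSetoid_anti (L := L) h)] at h1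
  rw [logClassSum_agreeSetoid, logClassSum_agreeSetoid] at h1
  have p := condEntropy_scale_pos (F := F) (W := W) hL
  unfold condEntropy
  have h2 : logClassSum (Setoid.ker enc ⊓ agreeSetoid L B)
      ≤ logClassSum (Setoid.ker enc ⊓ agreeSetoid L C)
        + (Fintype.card (Fin L → Dual F W) * (L * Real.log (Fintype.card F)))
          * (finrank F C - finrank F B) := by linarith
  have h3 := div_le_div_of_nonneg_right h2 p.le
  rw [add_div, mul_div_cancel_left₀ _ p.ne'] at h3
  linarith

theorem condEntropy_bot_le [Fintype S] (hL : 0 < L) :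
    condEntropy enc (⊥ : Submodule F W) ≤ Real.logb (Fintype.card F) (Fintype.card S) / L := by
  have h1 := card_mul_log_le_logClassSum_ker enc
  have h4 : Real.log (Fintype.card (Fin L → Dual F W))
      = finrank F W * (L * Real.log (Fintype.card F)) := by
    rw [Fintype.card_fun, Fintype.card_fin, Module.card_eq_pow_finrank (K := F),
      Subspace.dual_finrank_eq]
    push_cast
    rw [Real.log_pow, Real.log_pow]; ring
  rw [h4] at h1
  have p := condEntropy_scale_pos (F := F) (W := W) hL
  have p1 : (0 : ℝ) < Fintype.card (Fin L → Dual F W) := by exact_mod_cast Fintype.card_pos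
  have h2 : 0 < Real.log (Fintype.card F) :=
    Real.log_pos (by exact_mod_cast Fintype.one_lt_card)
  have h3 : (0 : ℝ) < L := by exact_mod_cast hL
  have h5 := div_le_div_of_nonneg_right h1 p.le
  rw [mul_div_mul_left _ _ p1.ne', sub_div, mul_div_cancel_right₀ _ (by positivity)] at h5
  have h6 : Real.log (Fintype.card S) / (L * Real.log (Fintype.card F))
      = Real.logb (Fintype.card F) (Fintype.card S) / L := by
    rw [Real.logb, div_div, mul_comm]
  rw [condEntropy, agreeSetoid_bot, inf_top_eq, finrank_bot]
  push_cast
  linarith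

/-- If the encoding and the values on `A` determine the values on `U`, then adjoining `U` to the
given data costs the entropy of `U` given `A`. -/
theorem condEntropy_step [FiniteDimensional F W] (hL : 0 < L) {A U : Submodule F W} (hAU : A ≤ U)
    (hdec : Setoid.ker enc ⊓ agreeSetoid L A ≤ agreeSetoid L U) (C : Submodule F W) :
    condEntropy enc (C ⊔ U) + (finrank F ↥(C ⊔ U) - finrank F ↥(C ⊔ A)) ≤ condEntropy enc C := by
  refine le_trans (le_of_eq ?_) (condEntropy_anti enc hL (le_sup_left : C ≤ C ⊔ A))
  have h : Setoid.ker enc ⊓ agreeSetoid L (C ⊔ U) = Setoid.ker enc ⊓ agreeSetoid L (C ⊔ A) := by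
    refine le_antisymm (inf_le_inf_left _ (agreeSetoid_anti (sup_le_sup_left hAU C))) ?_
    refine le_inf inf_le_left ?_
    rw [agreeSetoid_sup C U]
    refine le_inf (inf_le_right.trans (agreeSetoid_anti le_sup_left)) ?_
    exact (inf_le_inf_left _ (agreeSetoid_anti le_sup_right)).trans hdec
  rw [condEntropy, condEntropy, h]; ring

end ConditionalEntropy

/-! ### From a coding scheme to the converse -/

namespace LCBC

variable {F : Type u} [Field F] {d : ℕ}

/-- The data matrix whose columns represent the given functionals. -/
def dataMatrix {L : ℕ} (φ : Fin L → Dual F (Fin d → F)) : Matrix (Fin d) (Fin L) F :=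
  Matrix.of fun a i => φ i (Pi.single a 1)

theorem dataMatrix_transpose_mul {L m : ℕ} (φ : Fin L → Dual F (Fin d → F))
    (V : Matrix (Fin d) (Fin m) F) (i : Fin L) (j : Fin m) :
    ((dataMatrix φ).transpose * V) i j = φ i (V.col j) := by
  rw [LinearMap.pi_apply_eq_sum_univ (φ i) (V.col j), Matrix.mul_apply]
  refine Finset.sum_congr rfl fun a _ => ?_
  simp only [dataMatrix, Matrix.transpose_apply, Matrix.of_apply, Matrix.col_apply, smul_eq_mul]
  rw [mul_comm]
  congr 2
  ext b
  simp [Pi.single_apply, eq_comm]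

theorem agreeSetoid_colSpan_iff {L m : ℕ} {φ ψ : Fin L → Dual F (Fin d → F)}
    {V : Matrix (Fin d) (Fin m) F} :
    agreeSetoid L (colSpan V) φ ψ ↔
      (dataMatrix φ).transpose * V = (dataMatrix ψ).transpose * V := by
  constructor
  · intro h
    ext i j
    rw [dataMatrix_transpose_mul, dataMatrix_transpose_mul]
    exact h i _ (Submodule.subset_span ⟨j, rfl⟩)
  · intro h i w hw
    refine LinearMap.eqOn_span (f := φ i) (g := ψ i) (s := Set.range V.col) ?_ hw
    rintro _ ⟨j, rfl⟩
    rw [← dataMatrix_transpose_mul, ← dataMatrix_transpose_mul, h]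

/-- The number `c` is the normalized entropy of the broadcast. Decodability enters as the fact that
the encoding and the values on `sideSpace k` determine the values on `U k`. -/
theorem Scheme.gainBounds [Fintype F] {P : LCBC F 3 d} {L : ℕ} {S : Type u} [Fintype S] (hL : 0 < L)
    (σ : P.Scheme L S) :
    ∃ c ≤ Real.logb (Fintype.card F) (Fintype.card S) / L,
      P.GainBounds (((finrank F (P.U 0) : ℝ) - finrank F (P.sideSpace 0))
        + (finrank F (P.U 1) - finrank F (P.sideSpace 1))
        + (finrank F (P.U 2) - finrank F (P.sideSpace 2)) - c) := by
  have : Finite (Dual F (Fin d → F)) := Module.finite_of_finite F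
  have := Fintype.ofFinite (Dual F (Fin d → F))
  let enc : (Fin L → Dual F (Fin d → F)) → S := fun φ => σ.enc (dataMatrix φ)
  refine ⟨condEntropy enc ⊥, condEntropy_bot_le enc hL, P.gainBounds_of_submodular
    (condEntropy_nonneg enc hL) (fun k => condEntropy_step enc hL (P.sideSpace_le_U k) ?_)
    (condEntropy_submodular enc hL)⟩
  rw [U_eq_sup, agreeSetoid_sup]
  refine le_inf inf_le_right ?_
  rintro φ ψ ⟨h1, h2⟩
  rw [sideSpace, agreeSetoid_colSpan_iff] at h2
  rw [agreeSetoid_colSpan_iff, ← σ.decodes, ← σ.decodes, h2]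
  exact congrArg (fun s => σ.dec k s _) h1

end LCBC

/-! ### Powers of subspaces, and rounding of fractional solutions -/

section Power

variable {F W : Type*} [Field F] [AddCommGroup W] [Module F W]

/-- The vectors of length `z` with all entries in `U`. -/
def powerSubmodule (z : ℕ) (U : Submodule F W) : Submodule F (Fin z → W) :=
  Submodule.pi Set.univ fun _ => U

theorem mem_powerSubmodule {z : ℕ} {U : Submodule F W} {x : Fin z → W} :
    x ∈ powerSubmodule z U ↔ ∀ i, x i ∈ U := by
  simp [powerSubmodule]

theorem range_compLeft_eq_powerSubmodule {V : Type*} [AddCommGroup V] [Module F V]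
    (f : V →ₗ[F] W) (z : ℕ) :
    LinearMap.range (f.compLeft (Fin z)) = powerSubmodule z (LinearMap.range f) :=
  LinearMap.range_compLeft f _

theorem finrank_powerSubmodule [FiniteDimensional F W] (z : ℕ) (U : Submodule F W) :
    finrank F (powerSubmodule z U) = z * finrank F U := by
  have h1 := range_compLeft_eq_powerSubmodule U.subtype z
  rw [Submodule.range_subtype] at h1
  rw [← h1, LinearMap.finrank_range_of_inj, Module.finrank_pi_fintype]
  · simp
  · intro x y hxy
    ext i
    exact congrFun hxy i

theorem powerSubmodule_mono {z : ℕ} {U V : Submodule F W} (h : U ≤ V) :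
    powerSubmodule z U ≤ powerSubmodule z V := fun _ hx =>
  mem_powerSubmodule.2 fun i => h (mem_powerSubmodule.1 hx i)

theorem powerSubmodule_sup_le (z : ℕ) (U V : Submodule F W) :
    powerSubmodule z (U ⊔ V) ≤ powerSubmodule z U ⊔ powerSubmodule z V := by
  intro x hx
  have h : ∀ i, ∃ a ∈ U, ∃ b ∈ V, a + b = x i := fun i =>
    Submodule.mem_sup.1 (mem_powerSubmodule.1 hx i)
  choose a ha b hb hab using h
  exact Submodule.mem_sup.2 ⟨a, mem_powerSubmodule.2 ha, b, mem_powerSubmodule.2 hb, funext hab⟩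

theorem powerSubmodule_sup_finset_le {τ : Type*} (z : ℕ) (J : Finset τ) (R : τ → Submodule F W) :
    powerSubmodule z (J.sup R) ≤ J.sup fun t => powerSubmodule z (R t) := by
  classical
  induction J using Finset.induction_on with
  | empty =>
    intro x hx
    have : x = 0 := funext fun i => by simpa using mem_powerSubmodule.1 hx i
    simp [this]
  | insert t J ht ih =>
    rw [Finset.sup_insert, Finset.sup_insert]
    exact (powerSubmodule_sup_le z _ _).trans (sup_le_sup_left ih _)

/-- A fractional solution of the rank conditions yields integral ones for large powers. -/
theorem radoCondition_power [FiniteDimensional F W] {κ τ : Type*} {E : τ → Type*}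
    [∀ t, AddCommGroup (E t)] [∀ t, Module F (E t)] {s : κ → Finset τ}
    {π : κ → (t : τ) → E t →ₗ[F] W} {lam : τ → ℝ} (hlam : ∀ t, 0 ≤ lam t)
    {A : κ → Submodule F W}
    (h : ∀ k, ∀ J ⊆ s k, ∑ t ∈ J, lam t + finrank F (A k)
      ≤ finrank F ↥(A k ⊔ J.sup fun t => LinearMap.range (π k t))) (z : ℕ) :
    RadoCondition s (fun k t => (π k t).compLeft (Fin z)) (fun t => ⌊z * lam t⌋₊)
      (fun k => powerSubmodule z (A k)) := by
  intro k J hJ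
  have hz : (0 : ℝ) ≤ z := Nat.cast_nonneg z
  have h1 : powerSubmodule z (A k ⊔ J.sup fun t => LinearMap.range (π k t))
      ≤ powerSubmodule z (A k) ⊔ J.sup fun t => LinearMap.range ((π k t).compLeft (Fin z)) := by
    refine (powerSubmodule_sup_le z _ _).trans (sup_le_sup_left ?_ _)
    simp only [range_compLeft_eq_powerSubmodule]
    exact powerSubmodule_sup_finset_le z J _
  refine le_trans ?_ (Submodule.finrank_mono h1)
  rw [finrank_powerSubmodule, finrank_powerSubmodule]
  have h2 : ((∑ t ∈ J, ⌊z * lam t⌋₊ : ℕ) : ℝ) ≤ z * ∑ t ∈ J, lam t := by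
    push_cast
    rw [Finset.mul_sum]
    exact Finset.sum_le_sum fun t _ => Nat.floor_le (mul_nonneg hz (hlam t))
  have h3 := mul_le_mul_of_nonneg_left (h k J hJ) hz
  rw [mul_add] at h3
  have : ((∑ t ∈ J, ⌊z * lam t⌋₊ : ℕ) : ℝ) + z * finrank F (A k)
      ≤ z * finrank F ↥(A k ⊔ J.sup fun t => LinearMap.range (π k t)) := by linarith
  exact_mod_cast this

end Power

/-! ### The rank condition from the constraints of one user -/

section Rado

variable {F : Type u} [Field F] {d : ℕ}

/-- Five constraints suffice for all sixteen subsets `J`: since multiplicities are nonnegative, `J`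
may be compared with the largest set governed by the same constraint. That constraint is the one for
`D3` if `t3 ∈ J`, otherwise the one for whichever of `t1, t2` lie in `J`, otherwise the one for
`t0`. -/
theorem sum_le_condRank_sup {τ : Type*} [DecidableEq τ] {A : Submodule F (Fin d → F)}
    {R : τ → Submodule F (Fin d → F)} {lam : τ → ℝ} (hlam : ∀ t, 0 ≤ lam t) {t0 t1 t2 t3 : τ}
    (n01 : t0 ≠ t1) (n02 : t0 ≠ t2) (n03 : t0 ≠ t3) (n12 : t1 ≠ t2) (n13 : t1 ≠ t3)
    (n23 : t2 ≠ t3) {D0 D1 D2 D3 : Submodule F (Fin d → F)} (d0 : D0 ≤ R t0) (d1 : D1 ≤ R t1)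
    (d2 : D2 ≤ R t2) (d3 : D3 ≤ R t3) (h0 : lam t0 ≤ condRank D0 A)
    (h1 : lam t1 + lam t0 ≤ condRank D1 A) (h2 : lam t2 + lam t0 ≤ condRank D2 A)
    (h12 : lam t1 + lam t2 + lam t0 ≤ condRank (D1 ⊔ D2) A)
    (h3 : lam t3 + lam t1 + lam t2 + lam t0 ≤ condRank D3 A) {J : Finset τ}
    (hJ : J ⊆ {t0, t1, t2, t3}) : ∑ t ∈ J, lam t ≤ condRank (J.sup R) A := by
  have hmem : ∀ t ∈ J, t = t0 ∨ t = t1 ∨ t = t2 ∨ t = t3 := fun t ht => by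
    simpa using hJ ht
  have hle : ∀ T : Finset τ, J ⊆ T → ∑ t ∈ J, lam t ≤ ∑ t ∈ T, lam t := fun T hT =>
    Finset.sum_le_sum_of_subset_of_nonneg hT fun t _ _ => hlam t
  have hR : ∀ {D t}, t ∈ J → D ≤ R t → condRank D A ≤ condRank (J.sup R) A := fun ht hD =>
    condRank_mono (hD.trans (Finset.le_sup ht)) _
  by_cases m3 : t3 ∈ J
  · refine le_trans ?_ (hR m3 d3)
    have := hle _ hJ
    rw [Finset.sum_insert (by simp [*]), Finset.sum_insert (by simp [*]),
      Finset.sum_insert (by simp [*]), Finset.sum_singleton] at this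
    linarith
  by_cases m1 : t1 ∈ J
  · by_cases m2 : t2 ∈ J
    · refine le_trans ?_ (condRank_mono (sup_le (d1.trans (Finset.le_sup m1))
        (d2.trans (Finset.le_sup m2))) A)
      have := hle {t0, t1, t2} fun t ht => by
        rcases hmem t ht with rfl | rfl | rfl | rfl <;> simp_all
      rw [Finset.sum_insert (by simp [*]), Finset.sum_insert (by simp [*]),
        Finset.sum_singleton] at this
      linarith
    · refine le_trans ?_ (hR m1 d1)
      have := hle {t0, t1} fun t ht => by
        rcases hmem t ht with rfl | rfl | rfl | rfl <;> simp_all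
      rw [Finset.sum_insert (by simp [*]), Finset.sum_singleton] at this
      linarith
  by_cases m2 : t2 ∈ J
  · refine le_trans ?_ (hR m2 d2)
    have := hle {t0, t2} fun t ht => by
      rcases hmem t ht with rfl | rfl | rfl | rfl <;> simp_all
    rw [Finset.sum_insert (by simp [*]), Finset.sum_singleton] at this
    linarith
  by_cases m0 : t0 ∈ J
  · refine le_trans ?_ (hR m0 d0)
    have := hle {t0} fun t ht => by
      rcases hmem t ht with rfl | rfl | rfl | rfl <;> simp_all
    rw [Finset.sum_singleton] at this
    exact this.trans h0
  · have : J = ∅ := Finset.eq_empty_of_forall_notMem fun t ht => by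
      rcases hmem t ht with rfl | rfl | rfl | rfl <;> contradiction
    rw [this, Finset.sum_empty]
    exact condRank_nonneg _ _

end Rado

/-! ### The five message types and the broadcast space -/

namespace LCBC

variable {F : Type u} [Field F] {d : ℕ}

/-- The message types received by each user: type `0` is aimed at all users, types `1`, `2`, `3` at
the pairs of users `12`, `13`, `23`, and type `4` consists of triples with zero sum, one entry for
each user. -/
def receivedTypes : Fin 3 → Finset (Fin 5) :=
  ![{0, 1, 2, 4}, {0, 1, 3, 4}, {0, 2, 3, 4}]

/-- The vector for user `k` among the vectors for the three users. -/
def userProj (F : Type u) [Field F] (d : ℕ) (k : Fin 3) :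
    (Fin 3 → Fin d → F) →ₗ[F] (Fin d → F) :=
  LinearMap.proj k

/-- The messages of each type, by the vectors they provide to the three users. -/
def messages (P : LCBC F 3 d) (t : Fin 5) : Submodule F (Fin 3 → Fin d → F) :=
  Submodule.pi Set.univ P.U ⊓
    (![LinearMap.ker (userProj F d 0 - userProj F d 1) ⊓
          LinearMap.ker (userProj F d 0 - userProj F d 2),
        LinearMap.ker (userProj F d 0 - userProj F d 1),
        LinearMap.ker (userProj F d 0 - userProj F d 2),
        LinearMap.ker (userProj F d 1 - userProj F d 2),
        LinearMap.ker (userProj F d 0 + userProj F d 1 + userProj F d 2)] :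
      Fin 5 → Submodule F (Fin 3 → Fin d → F)) t

/-- The vector that a message provides to user `k`. -/
def received (P : LCBC F 3 d) (k : Fin 3) (t : Fin 5) : P.messages t →ₗ[F] (Fin d → F) :=
  (userProj F d k).comp (P.messages t).subtype

theorem range_received_le (P : LCBC F 3 d) (k : Fin 3) (t : Fin 5) :
    LinearMap.range (P.received k t) ≤ P.U k := by
  rintro _ ⟨e, rfl⟩
  exact Submodule.mem_pi.1 e.2.1 k (Set.mem_univ k)

theorem mem_range_received {P : LCBC F 3 d} {k : Fin 3} {t : Fin 5} {v : Fin d → F}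
    (w : Fin 3 → Fin d → F) (hw : w ∈ P.messages t) (hv : w k = v) :
    v ∈ LinearMap.range (P.received k t) :=
  ⟨⟨w, hw⟩, hv⟩

theorem U₃_le_range_received (P : LCBC F 3 d) (k : Fin 3) :
    P.U₃ 0 1 2 ≤ LinearMap.range (P.received k 0) := by
  rintro v ⟨⟨h0, h1⟩, h2⟩
  refine mem_range_received (fun _ => v) ⟨Submodule.mem_pi.2 fun i _ => ?_, ?_⟩ rfl
  · fin_cases i <;> assumption
  · simp [userProj]

theorem U₂_zero_one_le_range_received (P : LCBC F 3 d) (k : Fin 3) (hk : k ≠ 2) :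
    P.U₂ 0 1 ≤ LinearMap.range (P.received k 1) := by
  rintro v ⟨h0, h1⟩
  refine mem_range_received ![v, v, 0] ⟨Submodule.mem_pi.2 fun i _ => ?_, ?_⟩ ?_
  · fin_cases i
    exacts [h0, h1, zero_mem _]
  · simp [userProj]
  · fin_cases k <;> simp_all

theorem U₂_zero_two_le_range_received (P : LCBC F 3 d) (k : Fin 3) (hk : k ≠ 1) :
    P.U₂ 0 2 ≤ LinearMap.range (P.received k 2) := by
  rintro v ⟨h0, h1⟩
  refine mem_range_received ![v, 0, v] ⟨Submodule.mem_pi.2 fun i _ => ?_, ?_⟩ ?_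
  · fin_cases i
    exacts [h0, zero_mem _, h1]
  · simp [userProj]
  · fin_cases k <;> simp_all

theorem U₂_one_two_le_range_received (P : LCBC F 3 d) (k : Fin 3) (hk : k ≠ 0) :
    P.U₂ 1 2 ≤ LinearMap.range (P.received k 3) := by
  rintro v ⟨h0, h1⟩
  refine mem_range_received ![0, v, v] ⟨Submodule.mem_pi.2 fun i _ => ?_, ?_⟩ ?_
  · fin_cases i
    exacts [zero_mem _, h0, h1]
  · simp [userProj]
  · fin_cases k <;> simp_all

theorem UParen_zero_le_range_received (P : LCBC F 3 d) :
    P.UParen 0 1 2 ≤ LinearMap.range (P.received 0 4) := by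
  rintro v ⟨h0, h1⟩
  obtain ⟨x, hx, y, hy, rfl⟩ := Submodule.mem_sup.1 h1
  refine mem_range_received ![x + y, -x, -y] ⟨Submodule.mem_pi.2 fun i _ => ?_, ?_⟩ rfl
  · fin_cases i
    exacts [h0, neg_mem hx, neg_mem hy]
  · simp [userProj]

theorem UParen_one_le_range_received (P : LCBC F 3 d) :
    P.UParen 1 0 2 ≤ LinearMap.range (P.received 1 4) := by
  rintro v ⟨h0, h1⟩
  obtain ⟨x, hx, y, hy, rfl⟩ := Submodule.mem_sup.1 h1
  refine mem_range_received ![-x, x + y, -y] ⟨Submodule.mem_pi.2 fun i _ => ?_, ?_⟩ rfl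
  · fin_cases i
    exacts [neg_mem hx, h0, neg_mem hy]
  · simp [userProj]

theorem UParen_two_le_range_received (P : LCBC F 3 d) :
    P.UParen 2 0 1 ≤ LinearMap.range (P.received 2 4) := by
  rintro v ⟨h0, h1⟩
  obtain ⟨x, hx, y, hy, rfl⟩ := Submodule.mem_sup.1 h1
  refine mem_range_received ![-x, -y, x + y] ⟨Submodule.mem_pi.2 fun i _ => ?_, ?_⟩ rfl
  · fin_cases i
    exacts [neg_mem hx, neg_mem hy, h0]
  · simp [userProj, ← add_assoc]

/-- The number of messages of each type, per computation. -/
def LPVars.multiplicity (x : LPVars) : Fin 5 → ℝ := ![x.l123, x.l12, x.l13, x.l23, x.l]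

theorem LPFeasible.multiplicity_nonneg {P : LCBC F 3 d} {x : LPVars} (hx : P.LPFeasible x)
    (t : Fin 5) : 0 ≤ x.multiplicity t := by
  fin_cases t
  exacts [hx.nonneg_l123, hx.nonneg_l12, hx.nonneg_l13, hx.nonneg_l23, hx.nonneg_l]

theorem LPFeasible.rado {P : LCBC F 3 d} {x : LPVars} (hx : P.LPFeasible x) (k : Fin 3)
    (J : Finset (Fin 5)) (hJ : J ⊆ receivedTypes k) :
    ∑ t ∈ J, x.multiplicity t + finrank F (P.sideSpace k)
      ≤ finrank F ↥(P.sideSpace k ⊔ J.sup fun t => LinearMap.range (P.received k t)) := by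
  have key : ∑ t ∈ J, x.multiplicity t
      ≤ condRank (J.sup fun t => LinearMap.range (P.received k t)) (P.sideSpace k) := by
    fin_cases k
    · exact sum_le_condRank_sup hx.multiplicity_nonneg (t0 := 0) (t1 := 1) (t2 := 2) (t3 := 4)
        (by decide) (by decide) (by decide) (by decide) (by decide) (by decide)
        (P.U₃_le_range_received 0) (P.U₂_zero_one_le_range_received 0 (by decide))
        (P.U₂_zero_two_le_range_received 0 (by decide)) P.UParen_zero_le_range_received
        hx.c123_1 hx.c12_1 hx.c13_1 hx.c12_13 hx.c1 hJ
    · exact sum_le_condRank_sup hx.multiplicity_nonneg (t0 := 0) (t1 := 1) (t2 := 3) (t3 := 4)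
        (by decide) (by decide) (by decide) (by decide) (by decide) (by decide)
        (P.U₃_le_range_received 1) (P.U₂_zero_one_le_range_received 1 (by decide))
        (P.U₂_one_two_le_range_received 1 (by decide)) P.UParen_one_le_range_received
        hx.c123_2 hx.c12_2 hx.c23_2 hx.c12_23 hx.c2 hJ
    · exact sum_le_condRank_sup hx.multiplicity_nonneg (t0 := 0) (t1 := 2) (t2 := 3) (t3 := 4)
        (by decide) (by decide) (by decide) (by decide) (by decide) (by decide)
        (P.U₃_le_range_received 2) (P.U₂_zero_two_le_range_received 2 (by decide))
        (P.U₂_one_two_le_range_received 2 (by decide)) P.UParen_two_le_range_received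
        hx.c123_3 hx.c13_3 hx.c23_3 hx.c13_23 hx.c3 hJ
  rw [condRank, sup_comm] at key
  linarith

/-- In types `0` to `3` all recipients get the same vector, so one dimension is enough. In type `4`
the third vector is minus the sum of the other two, so two dimensions serve three users. -/
theorem exists_span_received (P : LCBC F 3 d) (z : ℕ) (t : Fin 5) (e : Fin z → P.messages t) :
    ∃ b : Submodule F (Fin z → Fin d → F), finrank F b ≤ (![1, 1, 1, 1, 2] : Fin 5 → ℕ) t ∧
      ∀ k, t ∈ receivedTypes k → (P.received k t).compLeft (Fin z) e ∈ b := by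
  have single : ∀ v : Fin z → Fin d → F, finrank F (Submodule.span F {v}) ≤ 1 := fun v =>
    (finrank_span_le_card _).trans (by simp)
  have hrel := fun i => (e i).2.2
  fin_cases t
  · refine ⟨Submodule.span F {(P.received 0 0).compLeft (Fin z) e}, single _, fun k _ => ?_⟩
    convert Submodule.mem_span_singleton_self _ using 1
    ext1 i
    have h := hrel i
    have h1 : (e i : Fin 3 → Fin d → F) 0 = (e i : Fin 3 → Fin d → F) 1 := sub_eq_zero.1 h.1
    have h2 : (e i : Fin 3 → Fin d → F) 0 = (e i : Fin 3 → Fin d → F) 2 := sub_eq_zero.1 h.2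
    fin_cases k
    exacts [rfl, h1.symm, h2.symm]
  · refine ⟨Submodule.span F {(P.received 0 1).compLeft (Fin z) e}, single _, fun k hk => ?_⟩
    convert Submodule.mem_span_singleton_self _ using 1
    ext1 i
    have h1 : (e i : Fin 3 → Fin d → F) 0 = (e i : Fin 3 → Fin d → F) 1 := sub_eq_zero.1 (hrel i)
    fin_cases k
    exacts [rfl, h1.symm, absurd hk (by decide)]
  · refine ⟨Submodule.span F {(P.received 0 2).compLeft (Fin z) e}, single _, fun k hk => ?_⟩
    convert Submodule.mem_span_singleton_self _ using 1
    ext1 i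
    have h1 : (e i : Fin 3 → Fin d → F) 0 = (e i : Fin 3 → Fin d → F) 2 := sub_eq_zero.1 (hrel i)
    fin_cases k
    exacts [rfl, absurd hk (by decide), h1.symm]
  · refine ⟨Submodule.span F {(P.received 1 3).compLeft (Fin z) e}, single _, fun k hk => ?_⟩
    convert Submodule.mem_span_singleton_self _ using 1
    ext1 i
    have h1 : (e i : Fin 3 → Fin d → F) 1 = (e i : Fin 3 → Fin d → F) 2 := sub_eq_zero.1 (hrel i)
    fin_cases k
    exacts [absurd hk (by decide), rfl, h1.symm]
  · refine ⟨Submodule.span F {(P.received 0 4).compLeft (Fin z) e} ⊔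
      Submodule.span F {(P.received 1 4).compLeft (Fin z) e},
      (Submodule.finrank_add_le_finrank_add_finrank _ _).trans
        (Nat.add_le_add (single _) (single _)), fun k _ => ?_⟩
    have m0 := Submodule.mem_sup_left (T := Submodule.span F {(P.received 1 4).compLeft (Fin z) e})
      (Submodule.mem_span_singleton_self (R := F) ((P.received 0 4).compLeft (Fin z) e))
    have m1 := Submodule.mem_sup_right (S := Submodule.span F {(P.received 0 4).compLeft (Fin z) e})
      (Submodule.mem_span_singleton_self (R := F) ((P.received 1 4).compLeft (Fin z) e))
    fin_cases k
    · exact m0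
    · exact m1
    · convert neg_mem (add_mem m0 m1) using 1
      ext1 i
      have h1 : (e i : Fin 3 → Fin d → F) 0 + (e i : Fin 3 → Fin d → F) 1
        + (e i : Fin 3 → Fin d → F) 2 = 0 := hrel i
      exact (neg_eq_of_add_eq_zero_right h1).symm

theorem LPFeasible.exists_broadcast [Finite F] {P : LCBC F 3 d} {x : LPVars}
    (hx : P.LPFeasible x) (z : ℕ) :
    ∃ B : Submodule F (Fin z → Fin d → F),
      (∀ k, powerSubmodule z (P.U k) ≤ powerSubmodule z (P.sideSpace k) ⊔ B) ∧
      (finrank F B : ℝ) ≤ z * P.lpObjective x + 48 := by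
  -- `c = 7` because 3 users and 5 types give `3 * 2 ^ 5 = 96 < 2 ^ 7`. The savings per message sum
  -- to 6, so the greedy stage loses at most `6 * 7 = 42`; rounding `z * λ` down loses at most 6
  -- more, which makes 48.
  obtain ⟨B, hB1, hB2⟩ := (radoCondition_power hx.multiplicity_nonneg hx.rado z).exists_broadcast
    (c := 7) (by simp) (fun k => powerSubmodule z (P.U k))
    (fun k t _ => by
      rw [range_compLeft_eq_powerSubmodule]
      exact powerSubmodule_mono (P.range_received_le k t))
    ![1, 1, 1, 1, 2] ![2, 1, 1, 1, 1] (by decide) (P.exists_span_received z) _ _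
    (fun k => powerSubmodule_mono (P.sideSpace_le_U k))
  refine ⟨B, hB1, ?_⟩
  simp only [finrank_powerSubmodule, Fin.sum_univ_five, Fin.sum_univ_three] at hB2
  have h : ((_ : ℕ) : ℝ) ≤ ((_ : ℕ) : ℝ) := Nat.cast_le.2 hB2
  simp only [LPVars.multiplicity, Matrix.cons_val] at h
  push_cast at h
  have f1 := (Nat.lt_floor_add_one (z * x.l123)).le
  have f2 := (Nat.lt_floor_add_one (z * x.l12)).le
  have f3 := (Nat.lt_floor_add_one (z * x.l13)).le
  have f4 := (Nat.lt_floor_add_one (z * x.l23)).le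
  have f5 := (Nat.lt_floor_add_one (z * x.l)).le
  rw [lpObjective_eq]
  linarith

/-! ### Linear schemes from broadcast spaces -/

/-- Evaluation of the data at a vector of the `z`-fold power of `F ^ d`. -/
def dataFunctional {z : ℕ} : Matrix (Fin d) (Fin z) F →ₗ[F] Dual F (Fin z → Fin d → F) :=
  LinearMap.mk₂ F (fun X w => ∑ i, ∑ a, X a i * w i a)
    (fun X Y w => by simp [add_mul, Finset.sum_add_distrib])
    (fun c X w => by simp [mul_assoc, Finset.mul_sum])
    (fun X v w => by simp [mul_add, Finset.sum_add_distrib])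
    (fun c X w => by simp [mul_left_comm, Finset.mul_sum])

theorem dataFunctional_single {z m : ℕ} (X : Matrix (Fin d) (Fin z) F)
    (V : Matrix (Fin d) (Fin m) F) (i : Fin z) (j : Fin m) :
    dataFunctional X (Pi.single i (V.col j)) = (X.transpose * V) i j := by
  rw [dataFunctional, LinearMap.mk₂_apply, Finset.sum_eq_single i]
  · simp [Matrix.mul_apply]
  · intro b _ hb
    simp [Pi.single_eq_of_ne hb]
  · simp

theorem dataFunctional_eq_zero_of_mem {z m : ℕ} {X : Matrix (Fin d) (Fin z) F}
    {V : Matrix (Fin d) (Fin m) F} (h : X.transpose * V = 0) {w : Fin z → Fin d → F}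
    (hw : w ∈ powerSubmodule z (colSpan V)) : dataFunctional X w = 0 := by
  have h1 : ∀ i, ∀ v ∈ colSpan V, dataFunctional X (Pi.single i v) = 0 := by
    intro i v hv
    refine LinearMap.eqOn_span (f := (dataFunctional X).comp (LinearMap.single F (fun _ => Fin d → F) i)) (g := 0)
      (s := Set.range V.col) ?_ hv
    rintro _ ⟨j, rfl⟩
    change dataFunctional X (Pi.single i (V.col j)) = 0
    rw [dataFunctional_single, h]; rfl
  rw [← Finset.univ_sum_single w, map_sum]
  exact Finset.sum_eq_zero fun i _ => h1 i _ (mem_powerSubmodule.1 hw i)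

/-- A broadcast space yields a linear scheme. -/
theorem exists_scheme_of_broadcast {K : ℕ} (P : LCBC F K d) {z : ℕ}
    {B : Submodule F (Fin z → Fin d → F)}
    (hB : ∀ k, powerSubmodule z (P.U k) ≤ powerSubmodule z (P.sideSpace k) ⊔ B) :
    Nonempty (P.Scheme z (Dual F B)) := by
  classical
  let enc : Matrix (Fin d) (Fin z) F → Dual F B := fun X => (dataFunctional X).domRestrict B
  have key : ∀ k X Y, enc X = enc Y → X.transpose * P.V' k = Y.transpose * P.V' k →
      X.transpose * P.V k = Y.transpose * P.V k := by
    intro k X Y h1 h2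
    have h2' : (X - Y).transpose * P.V' k = 0 := by
      rw [Matrix.transpose_sub, Matrix.sub_mul, h2, sub_self]
    have hzero : ∀ w ∈ powerSubmodule z (P.U k), dataFunctional (X - Y) w = 0 := by
      intro w hw
      obtain ⟨a, ha, b, hb, rfl⟩ := Submodule.mem_sup.1 (hB k hw)
      rw [map_add, dataFunctional_eq_zero_of_mem h2' ha, zero_add, map_sub, LinearMap.sub_apply,
        sub_eq_zero]
      exact LinearMap.congr_fun h1 ⟨b, hb⟩
    rw [← sub_eq_zero, ← Matrix.sub_mul, ← Matrix.transpose_sub]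
    ext i j
    rw [← dataFunctional_single]
    refine hzero _ (mem_powerSubmodule.2 fun i' => ?_)
    have hcol : (P.V k).col j ∈ P.U k := by
      rw [U_eq_sup]
      exact Submodule.mem_sup_right (Submodule.subset_span ⟨j, rfl⟩)
    by_cases hi : i' = i
    · subst hi; simpa using hcol
    · rw [Pi.single_eq_of_ne hi]; exact zero_mem _
  -- The decoder answers for any data consistent with what the user sees. By `key` the answer does
  -- not depend on the choice, and the value `0` occurs only on inputs that never arise.
  refine ⟨⟨enc, fun k s Y => if h : ∃ X, enc X = s ∧ X.transpose * P.V' k = Y then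
    h.choose.transpose * P.V k else 0, fun k X => ?_⟩⟩
  have h : ∃ X', enc X' = enc X ∧ X'.transpose * P.V' k = X.transpose * P.V' k := ⟨X, rfl, rfl⟩
  rw [dif_pos h]
  exact key k _ _ h.choose_spec.1 h.choose_spec.2

/-! ### Matching the two bounds -/

theorem LPFeasible.exists_achievable [Fintype F] {P : LCBC F 3 d} {x : LPVars}
    (hx : P.LPFeasible x) {z : ℕ} (hz : 0 < z) :
    ∃ c ∈ P.achievableCosts, c ≤ P.lpObjective x + 48 / z := by
  obtain ⟨B, hB1, hB2⟩ := hx.exists_broadcast z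
  have : Finite (Dual F B) := Module.finite_of_finite F
  have := Fintype.ofFinite (Dual F B)
  refine ⟨_, ⟨z, Dual F B, this, hz, P.exists_scheme_of_broadcast hB1, rfl⟩, ?_⟩
  have hF : (1 : ℝ) < Fintype.card F := by exact_mod_cast Fintype.one_lt_card
  rw [Module.card_eq_pow_finrank (K := F) (V := Dual F B), Subspace.dual_finrank_eq]
  push_cast
  rw [Real.logb_pow, Real.logb_self_eq_one hF, mul_one]
  have hz' : (0 : ℝ) < z := by exact_mod_cast hz
  rw [div_le_iff₀ hz', add_mul, div_mul_cancel₀ _ hz'.ne']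
  linarith

theorem LPFeasible.isGLB [Fintype F] {P : LCBC F 3 d} {x : LPVars} (hx : P.LPFeasible x)
    (hopt : ∀ G, P.GainBounds G → G ≤ 2 * x.l123 + x.l12 + x.l13 + x.l23 + x.l) :
    IsGLB P.achievableCosts (P.lpObjective x) := by
  constructor
  · rintro c ⟨L, S, _, hL, ⟨σ⟩, rfl⟩
    obtain ⟨c, hc, hG⟩ := σ.gainBounds hL
    have := hopt _ hG
    rw [lpObjective_eq]
    linarith
  · intro b hb
    refine le_of_forall_pos_le_add fun ε hε => ?_
    obtain ⟨z, hz⟩ := exists_nat_gt (48 / ε)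
    have hz0 : (0 : ℝ) < z := lt_trans (by positivity) hz
    obtain ⟨c, hc, hle⟩ := hx.exists_achievable (z := z) (by exact_mod_cast hz0)
    have h1 : 48 / (z : ℝ) ≤ ε := by
      rw [div_le_iff₀ hz0]
      rw [div_lt_iff₀ hε] at hz
      linarith
    exact (hb hc).trans (hle.trans (by linarith))

theorem LPFeasible.isLeast {P : LCBC F 3 d} {x : LPVars} (hx : P.LPFeasible x)
    (hopt : ∀ G, P.GainBounds G → G ≤ 2 * x.l123 + x.l12 + x.l13 + x.l23 + x.l) :
    IsLeast P.lpValues (P.lpObjective x) := by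
  refine ⟨⟨x, hx, rfl⟩, ?_⟩
  rintro v ⟨y, hy, rfl⟩
  have := hopt _ hy.gainBounds
  rw [lpObjective_eq, lpObjective_eq]
  linarith

end LCBC

/-- For every instance of the 3-user LCBC over a finite field, the optimal broadcast cost `Δ*`
(a genuine infimum of achievable costs) equals the optimal value `F*` of the linear program
(a genuine, attained minimum). -/
theorem theorem3 {F : Type u} [Field F] [Fintype F] {d : ℕ} (P : LCBC F 3 d) :
    IsGLB P.achievableCosts P.optimalBroadcastCost ∧
      IsLeast P.lpValues P.lpOptimum ∧
      P.optimalBroadcastCost = P.lpOptimum := by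
  obtain ⟨x, hx, hopt⟩ := P.exists_lp_optimal
  have hglb := hx.isGLB hopt
  have hleast := hx.isLeast hopt
  -- Batch size 1 already shows that the set of costs is nonempty, so its greatest lower bound is
  -- its real `sInf`.
  obtain ⟨c, hc, -⟩ := hx.exists_achievable one_pos
  have h1 : P.optimalBroadcastCost = P.lpObjective x := hglb.csInf_eq ⟨c, hc⟩
  have h2 : P.lpOptimum = P.lpObjective x := hleast.csInf_eq
  rw [h1, h2]
  exact ⟨hglb, hleast, rfl⟩
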